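/- **Setting.** Let $a_1,\dots,a_n\in\mathbb{R}^d$ be nonzero (row) vectors, $1\le d\le n$, $n\ge 2$, let $b\in\mathbb{R}^n$, and let $F(x)=\sum_{i=1}^n f_i(x)$ with $f_i(x)=\tfrac12(a_ix-b_i)^2$. Let $q\ge 1$, let $\omega_1,\dots,\omega_n>0$ be weights, let $\tau_0,\tau_1,\dots$ be batches of $q$ indices from $\{1,\dots,n\}$ (repetitions allowed, an arbitrary outcome of the random choice) with $\sum_{i\in\tau_k}\omega_i\le q$ for all $k$, and let $x_0\in\mathbb{R}^d$ be a unit vector. Mini-batch reweighted stochastic gradient descent on $F$ is $$x_{k+1}=x_k-\frac1q\sum_{i\in\tau_k}\frac{\omega_i}{\|a_i\|^2}\nabla f_i(x_k).$$ Put $c_i=b_i/\|a_i\|$, $|A_i\rangle=a_i/\|a_i\|$, $v_0=1$, $v_{k+1}=\big(v_k^2+\sum_{i\in\tau_k}c_i^2\big)^{1/2}$ (all sums over $i\in\tau_k$ in this paragraph count repetitions). For a row $i$ let $\omega_{k,i}$ be $\omega_i/q$ times the number of occurrences of $i$ in $\tau_k$, and let $t_k=\sum_i\omega_{k,i}\le1$,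 $s_{k,i}=\sqrt{\omega_{k,i}/t_k}$. **Algorithm (quantum multi-row iteration).** Start with $|X_0\rangle=\sum_i s_{0,i}|i\rangle|x_0\rangle$, where $|x_0\rangle=\sum_j x_{0,j}|j\rangle$. For $k=0,\dots,K-1$: load $|Y_k\rangle=\beta_k|0\rangle|X_k\rangle+|1\rangle\sum_i\gamma_{k,i}s_{k,i}|i\rangle|A_i\rangle$ with $\beta_k=v_k/v_{k+1}$, $\gamma_{k,i}=c_i/v_{k+1}$; apply $U_k=I\otimes(I-\Sigma_k)+X\otimes\Sigma_k$, where $X$ is the Pauli NOT and $\Sigma_k=t_k\sum_{i\in\tau_k}|i\rangle\langle i|\otimes|A_i\rangle\langle A_i|$ (sum over distinct $i$), and keep the component with flag $0$; apply the exchange operator $|s_{k+1}\rangle\langle s_k|$, with $|s_k\rangle=\sum_i s_{k,i}|i\rangle$, to the index register, giving $|X_{k+1}\rangle$. Finally apply $\langle s_K|$ to the index register. All discarded components are flagged as orthogonal garbage. **Access model.** The data are held in a quantum memory, accessed by unitaries (also available as adjoints and controlled by one qubit) of which only the following is assumed: $V|i\rangle|0\rangle=|i\rangle|A_i\rangle$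 for all $i$; $G_k|0\rangle=\sum_i\sqrt{\omega_{k,i}}\,|i\rangle|0\rangle+|\cdot\rangle|1\rangle$, the second term being an arbitrary redundant part; $R_k|i\rangle|0\rangle=|i\rangle\big(r|0\rangle+\sqrt{1-r^2}\,|1\rangle\big)$ for $i\in\tau_k$, with $r=c_i/(\sum_{l\in\tau_k}c_l^2)^{1/2}$ (and $r=0$ if the denominator vanishes); and a preparation $|0\rangle\mapsto|x_0\rangle$. One use of any of them is one query. An elementary gate is a one-qubit unitary with at most two control qubits. **Corollary 2.** There is an absolute constant $C$ such that the following holds for all $n,d,q,\omega,(\tau_k),c$ as above and all $K\ge1$. There is a quantum circuit with at most $CK$ queries and at most $CK\log n$ elementary gates, which depends on $n,d,q,K,\omega,(\tau_k)$ and $c$ only, such that for all $a$, $b$ with $c_i=b_i/\|a_i\|$, all unit $x_0$ and all memory-access unitaries as above, it maps the all-zero state to the output state of the algorithm, and this state encodes the result $x_K$ of $K$ iterations of stochastic gradient descent: $$|0\cdots0\rangle\otimes\frac1{v_K}\sum_{j}x_{K,j}|j\rangle\;+\;|\mathrm{Gb}\rangle,$$ where the last register displayed is the work register and the garbage $|\mathrm{Gb}\rangle$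 is orthogonal to $|0\cdots0\rangle\otimes|\psi\rangle$ for every state $|\psi\rangle$ of the work register. -/

import Mathlib

open scoped Kronecker

noncomputable section

/-! ## Quantum circuits with memory queries -/

/-- A gate of a circuit on the set of qubits `W`, with memory-access operators (oracles) named by
`Q`; the operator `o` acts on the qubits `port o`. A gate is either elementary (a one-qubit unitary
with at most two control qubits, e.g. a rotation, a CNOT or a Toffoli gate), or a query to a
memory-access operator or to its adjoint, possibly controlled by one qubit. -/
inductive Gate (W Q : Type) (port : Q → Type) where
  | elementary (u : Matrix.unitaryGroup Bool ℂ) (target : W) (controls : Finset W)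
      (hcard : controls.card ≤ 2) (htarget : target ∉ controls) : Gate W Q port
  | query (o : Q) (adjoint : Bool) (wires : port o ↪ W) (controls : Finset W)
      (hcard : controls.card ≤ 1) (hwires : ∀ p, wires p ∉ controls) : Gate W Q port

/-- A circuit: the gates in the order in which they are applied. -/
abbrev Circuit (W Q : Type) (port : Q → Type) : Type := List (Gate W Q port)

namespace Gate

variable {W Q : Type} {port : Q → Type}

/-- Is the gate a memory query? -/
def isQuery : Gate W Q port → Bool
  | elementary _ _ _ _ _ => false
  | query _ _ _ _ _ _ => true

/-- Action of a gate on a vector of amplitudes (indexed by the computational basis `W → Bool`),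
the unitaries behind the queries being given by `O`. -/
def act [DecidableEq W] [∀ o, Fintype (port o)] [∀ o, DecidableEq (port o)]
    (O : ∀ o, Matrix.unitaryGroup (port o → Bool) ℂ) :
    Gate W Q port → ((W → Bool) → ℂ) → ((W → Bool) → ℂ)
  | elementary u t cs _ _, ψ => fun x =>
      if ∀ w ∈ cs, x w = true then
        ∑ y : Bool, (u : Matrix Bool Bool ℂ) (x t) y * ψ (Function.update x t y)
      else ψ x
  | query o adj e cs _ _, ψ => fun x =>
      if ∀ w ∈ cs, x w = true then
        ∑ y : port o → Bool,
          (if adj then star (O o : Matrix (port o → Bool) (port o → Bool) ℂ)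
            else (O o : Matrix (port o → Bool) (port o → Bool) ℂ)) (fun p => x (e p)) y *
              ψ (Function.extend e y x)
      else ψ x

end Gate

namespace Circuit

variable {W Q : Type} {port : Q → Type}

/-- Number of memory queries (controlled and adjoint ones included). -/
def queryCount (P : Circuit W Q port) : ℕ := P.countP (fun g => g.isQuery)

/-- Number of elementary gates. -/
def gateCount (P : Circuit W Q port) : ℕ := P.countP (fun g => !g.isQuery)

/-- The state produced from the all-zero basis state. -/
def run [Fintype W] [DecidableEq W] [∀ o, Fintype (port o)] [∀ o, DecidableEq (port o)]
    (O : ∀ o, Matrix.unitaryGroup (port o → Bool) ℂ) (P : Circuit W Q port) : (W → Bool) → ℂ :=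
  P.foldl (fun ψ g => g.act O ψ) (Pi.single (fun _ => false) 1)

end Circuit

/-- Number of qubits of a register that can hold the numbers `0, …, N - 1`. -/
abbrev qubits (N : ℕ) : ℕ := Nat.clog 2 N

/-- Binary encoding of `i < N` as a basis state of such a register. -/
def enc {N : ℕ} (i : Fin N) : Fin (qubits N) → Bool := fun p => i.val.testBit p

/-! ## The loss function and stochastic gradient descent -/

/-- `f_i(x) = ½ (a_i x - b_i)²`. -/
def lossTerm {n d : ℕ} (a : Fin n → EuclideanSpace ℝ (Fin d)) (b : Fin n → ℝ) (i : Fin n)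
    (x : EuclideanSpace ℝ (Fin d)) : ℝ :=
  1 / 2 * (inner ℝ (a i) x - b i) ^ 2

/-- `F = ∑ i, f_i`. -/
def loss {n d : ℕ} (a : Fin n → EuclideanSpace ℝ (Fin d)) (b : Fin n → ℝ)
    (x : EuclideanSpace ℝ (Fin d)) : ℝ :=
  ∑ i, lossTerm a b i x

/-- Mini-batch, reweighted stochastic gradient descent on `loss a b`: step `k` uses the batch
`τ k 0, …, τ k (q - 1)` (repetitions allowed),
`x_{k+1} = x_k - (1/q) ∑_{i ∈ τ_k} (ω_i / ‖a_i‖²) ∇f_i(x_k)`. -/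
def sgd {n d q : ℕ} (a : Fin n → EuclideanSpace ℝ (Fin d)) (b : Fin n → ℝ) (ω : Fin n → ℝ)
    (τ : ℕ → Fin q → Fin n) (x₀ : EuclideanSpace ℝ (Fin d)) : ℕ → EuclideanSpace ℝ (Fin d)
  | 0 => x₀
  | k + 1 =>
      sgd a b ω τ x₀ k -
        (1 / (q : ℝ)) • ∑ j : Fin q, (ω (τ k j) / ‖a (τ k j)‖ ^ 2) •
          gradient (lossTerm a b (τ k j)) (sgd a b ω τ x₀ k)

/-! ## The quantum multi-row iteration algorithm

Only the component of each state on which all flag qubits are `0` (or, for `algY`, all but the one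
of the current iteration) is recorded; everything else is the garbage state, which stays orthogonal
to it. Such a component is a vector of amplitudes on the index register `|i⟩`, `i < n`, and the work
register `|j⟩`, `j < d`. The right-hand side enters through `c i = b i / ‖a i‖`. -/

section Algorithm

variable {n d q : ℕ}

/-- The modified weight `ω_{k,i} = ω_i / q` of row `i` in batch `k`, with multiplicity. -/
def batchWeight (ω : Fin n → ℝ) (τ : ℕ → Fin q → Fin n) (k : ℕ) (i : Fin n) : ℝ :=
  ∑ j : Fin q, if τ k j = i then ω i / q else 0

/-- `t_k = ∑_i ω_{k,i}`. -/
def totalWeight (ω : Fin n → ℝ) (τ : ℕ → Fin q → Fin n) (k : ℕ) : ℝ :=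
  ∑ i, batchWeight ω τ k i

/-- The amplitudes `s_{k,i}` of the index register; uniform on the batch if the weights are. -/
def idxAmp (ω : Fin n → ℝ) (τ : ℕ → Fin q → Fin n) (k : ℕ) (i : Fin n) : ℝ :=
  √(batchWeight ω τ k i / totalWeight ω τ k)

/-- `(∑_{i ∈ τ_k} c_i²)^{1/2}`. -/
def batchNorm (c : Fin n → ℝ) (τ : ℕ → Fin q → Fin n) (k : ℕ) : ℝ :=
  √(∑ j : Fin q, c (τ k j) ^ 2)

/-- The normalization factors: `v_0 = 1`, `v_{k+1} = (v_k² + ∑_{i ∈ τ_k} c_i²)^{1/2}`. -/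
def algV (c : Fin n → ℝ) (τ : ℕ → Fin q → Fin n) : ℕ → ℝ
  | 0 => 1
  | k + 1 => √(algV c τ k ^ 2 + batchNorm c τ k ^ 2)

/-- The amplitude `⟨j|A_i⟩` of the normalized row `|A_i⟩`. -/
def rowAmp (a : Fin n → EuclideanSpace ℝ (Fin d)) (i : Fin n) (j : Fin d) : ℝ := a i j / ‖a i‖

/-- `Σ_{τ_k} = t_k ∑_{i ∈ τ_k} |i⟩⟨i| ⊗ |A_i⟩⟨A_i|`. -/
def algSigma (a : Fin n → EuclideanSpace ℝ (Fin d)) (ω : Fin n → ℝ) (τ : ℕ → Fin q → Fin n)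
    (k : ℕ) : Matrix (Fin n × Fin d) (Fin n × Fin d) ℝ :=
  totalWeight ω τ k • ∑ i ∈ Finset.univ.image (τ k),
    Matrix.single i i 1 ⊗ₖ Matrix.vecMulVec (rowAmp a i) (rowAmp a i)

/-- The iteration operator `U_k = I ⊗ (I - Σ_{τ_k}) + X ⊗ Σ_{τ_k}`, acting on a flag qubit, the
index register and the work register. -/
def algU (a : Fin n → EuclideanSpace ℝ (Fin d)) (ω : Fin n → ℝ) (τ : ℕ → Fin q → Fin n)
    (k : ℕ) : Matrix (Fin 2 × (Fin n × Fin d)) (Fin 2 × (Fin n × Fin d)) ℝ :=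
  (1 : Matrix (Fin 2) (Fin 2) ℝ) ⊗ₖ (1 - algSigma a ω τ k) + !![0, 1; 1, 0] ⊗ₖ algSigma a ω τ k

/-- Loading: `Y_k = β_k |0⟩ X_k + |1⟩ ∑_{i ∈ τ_k} γ_{k,i} s_{k,i} |i⟩|A_i⟩`, with
`β_k = v_k / v_{k+1}` and `γ_{k,i} = c_i / v_{k+1}`. -/
def algY (a : Fin n → EuclideanSpace ℝ (Fin d)) (c ω : Fin n → ℝ) (τ : ℕ → Fin q → Fin n)
    (k : ℕ) (X : Fin n × Fin d → ℝ) : Fin 2 × (Fin n × Fin d) → ℝ := fun p =>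
  if p.1 = 0 then algV c τ k / algV c τ (k + 1) * X p.2
  else c p.2.1 / algV c τ (k + 1) * idxAmp ω τ k p.2.1 * rowAmp a p.2.1 p.2.2

/-- Iteration: `Z_{k+1}` is the component of `U_k Y_k` with flag `0`. -/
def algZ (a : Fin n → EuclideanSpace ℝ (Fin d)) (c ω : Fin n → ℝ) (τ : ℕ → Fin q → Fin n)
    (k : ℕ) (X : Fin n × Fin d → ℝ) : Fin n × Fin d → ℝ := fun p =>
  (algU a ω τ k).mulVec (algY a c ω τ k X) (0, p)

/-- The projection `⟨s_k| ⊗ I`; it maps `∑_i s_{k,i} |i⟩|x⟩` to `|x⟩`. -/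
def algAdd (ω : Fin n → ℝ) (τ : ℕ → Fin q → Fin n) (k : ℕ) (X : Fin n × Fin d → ℝ) :
    Fin d → ℝ := fun j =>
  ∑ i, idxAmp ω τ k i * X (i, j)

/-- The states `X_k`: `X_0 = ∑_i s_{0,i} |i⟩|x₀⟩`, and `X_{k+1}` is obtained from `Z_{k+1}` by the
exchange operator `P = |s_{k+1}⟩⟨s_k|` on the index register. -/
def algX (a : Fin n → EuclideanSpace ℝ (Fin d)) (c ω : Fin n → ℝ) (τ : ℕ → Fin q → Fin n)
    (x₀ : EuclideanSpace ℝ (Fin d)) : ℕ → Fin n × Fin d → ℝ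
  | 0 => fun p => idxAmp ω τ 0 p.1 * x₀ p.2
  | k + 1 => fun p =>
      idxAmp ω τ (k + 1) p.1 * algAdd ω τ k (algZ a c ω τ k (algX a c ω τ x₀ k)) p.2

/-- The output after `K` iterations: the amplitudes on `|0⋯0⟩|j⟩`, `j < d`. -/
def algOutput (a : Fin n → EuclideanSpace ℝ (Fin d)) (c ω : Fin n → ℝ) (τ : ℕ → Fin q → Fin n)
    (x₀ : EuclideanSpace ℝ (Fin d)) (K : ℕ) : Fin d → ℝ :=
  algAdd ω τ K (algX a c ω τ x₀ K)

end Algorithm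

/-! ## The quantum memory -/

/-- The memory-access operators: the row read-out `V`; for each batch `k` the weight loader `G_k`
and the rotation `R_k` holding the right-hand side; the preparation of the initial vector. -/
inductive Mem : Type where
  | row : Mem
  | weight (k : ℕ) : Mem
  | rhs (k : ℕ) : Mem
  | init : Mem

/-- The qubits on which they act: `V` on an index and a work register; `G_k` on an index register
and a redundancy qubit (`2n` leaves); `R_k` on an index register and a qubit; the preparation on a
work register. -/
def memPort (n d : ℕ) : Mem → Type
  | .row => Fin (qubits n) ⊕ Fin (qubits d)
  | .weight _ => Fin (qubits n) ⊕ Unit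
  | .rhs _ => Fin (qubits n) ⊕ Unit
  | .init => Fin (qubits d)

instance memPortFintype (n d : ℕ) : ∀ o, Fintype (memPort n d o)
  | .row => inferInstanceAs (Fintype (Fin (qubits n) ⊕ Fin (qubits d)))
  | .weight _ => inferInstanceAs (Fintype (Fin (qubits n) ⊕ Unit))
  | .rhs _ => inferInstanceAs (Fintype (Fin (qubits n) ⊕ Unit))
  | .init => inferInstanceAs (Fintype (Fin (qubits d)))

instance memPortDecidableEq (n d : ℕ) : ∀ o, DecidableEq (memPort n d o)
  | .row => inferInstanceAs (DecidableEq (Fin (qubits n) ⊕ Fin (qubits d)))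
  | .weight _ => inferInstanceAs (DecidableEq (Fin (qubits n) ⊕ Unit))
  | .rhs _ => inferInstanceAs (DecidableEq (Fin (qubits n) ⊕ Unit))
  | .init => inferInstanceAs (DecidableEq (Fin (qubits d)))

/-- Amplitude at the basis state `y` of the vector `∑_j x_j |j⟩`. -/
def ampAt {N : ℕ} (x : Fin N → ℝ) (y : Fin (qubits N) → Bool) : ℂ :=
  ∑ j, if y = enc j then (x j : ℂ) else 0

/-- The unitaries `O` give access to the data. Their action is prescribed only on the inputs
shown; the redundant part of the weight state (redundancy qubit `1`) is arbitrary. -/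
structure IsMemory {n d q : ℕ} (a : Fin n → EuclideanSpace ℝ (Fin d)) (c ω : Fin n → ℝ)
    (τ : ℕ → Fin q → Fin n) (x₀ : EuclideanSpace ℝ (Fin d))
    (O : ∀ o, Matrix.unitaryGroup (memPort n d o → Bool) ℂ) : Prop where
  /-- `V |i⟩|0⟩ = |i⟩|A_i⟩`. -/
  row : ∀ (i : Fin n) (y : Fin (qubits n) → Bool) (w : Fin (qubits d) → Bool),
    (O .row).1 (Sum.elim y w) (Sum.elim (enc i) fun _ => false) =
      if y = enc i then ampAt (rowAmp a i) w else 0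
  /-- `G_k |0⟩ = ∑_{i ∈ τ_k} √ω_{k,i} |i⟩|0⟩ + (redundant part) |1⟩`. -/
  weight : ∀ (k : ℕ) (y : Fin (qubits n) → Bool),
    (O (.weight k)).1 (Sum.elim y fun _ => false) (fun _ => false) =
      ampAt (fun i => √(batchWeight ω τ k i)) y
  /-- `R_k |i⟩|0⟩ = |i⟩ (r |0⟩ + √(1 - r²) |1⟩)` with `r = c_i / (∑_{l ∈ τ_k} c_l²)^{1/2}`, for `i`
  in the batch `τ_k`. -/
  rhs : ∀ (k : ℕ) (j : Fin q) (y : Fin (qubits n) → Bool) (z : Bool),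
    (O (.rhs k)).1 (Sum.elim y fun _ => z) (Sum.elim (enc (τ k j)) fun _ => false) =
      if y = enc (τ k j) then
        (if z then ((√(1 - (c (τ k j) / batchNorm c τ k) ^ 2) : ℝ) : ℂ)
          else ((c (τ k j) / batchNorm c τ k : ℝ) : ℂ))
      else 0
  /-- `|0⟩ ↦ |x₀⟩`. -/
  init : ∀ w : Fin (qubits d) → Bool, (O .init).1 w (fun _ => false) = ampAt x₀ w

end

/-! Algebra: normalizing the rows turns one step of gradient descent into x ↦ x + ∑_i ω_{k,i} (c_i −
⟨A_i, x⟩) A_i. Since t_k s_{k,i}² = ω_{k,i}, compressing I − Σ_k by s_k gives I − ∑_i ω_{k,i}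
|A_i⟩⟨A_i|, and the loaded term contributes ∑_i ω_{k,i} c_i A_i. Hence X_k = s_k ⊗ x_k / v_k
(`algX_eq`), and the output is x_K / v_K.

Circuit: it reaches the same output without following the intermediate states X_k. All loading
amplitudes are set aside at the start: a mode qubit is rotated so that mode 0 carries x_0 / v_K and
mode 1 carries the remaining weight, a waiting amplitude on work register 0. Iteration k splits from
the waiting part the amplitude (∑_{i ∈ τ_k} c_i²)^{1/2} / v_K, marks it with a flag, and leaves
x_{k+1} / v_K on mode 0. The denominator is v_K throughout, so no state needs rescaling on the way;
the waiting amplitudes form a Pythagorean chain because v_{k+1}² − v_k² is the squared norm of the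
batch.

Within an iteration, G_k and later its adjoint act on a fresh index register; projecting that
register and the redundancy qubit on 0 averages over the rows with weights ω_{k,i}, which replaces
both the factor t_k and the exchange operator. Between them, V† on flag 0, a NOT of the flag on the
states |i⟩|0⟩ with i < n, and V realize I ⊗ (I − |A_i⟩⟨A_i|) + X ⊗ |A_i⟩⟨A_i| on the states that
matter. On flag 1 no V† is applied, because it would only undo the V that loads A_i.
`act_stepCircuit` computes the result.

Ancillas are never reused, so the component with all ancillas 0 evolves on its own
(`IsCleanFrom.act_onWires`). Each iteration costs five queries and one multiply controlled NOT,
which a ladder of Toffoli gates performs in O(log n) gates. -/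

theorem hasGradientAt_lossTerm {n d : ℕ} (a : Fin n → EuclideanSpace ℝ (Fin d)) (b : Fin n → ℝ)
    (i : Fin n) (x : EuclideanSpace ℝ (Fin d)) :
    HasGradientAt (lossTerm a b i) ((inner ℝ (a i) x - b i) • a i) x := by
  rw [hasGradientAt_iff_hasFDerivAt]
  have h : HasFDerivAt (fun x => inner ℝ (a i) x - b i) (innerSL ℝ (a i)) x :=
    ((innerSL ℝ (a i)).hasFDerivAt).sub_const _
  have h2 := (h.pow 2).const_mul (1 / 2)
  refine h2.congr_fderiv ?_
  ext y
  simp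
  ring

/-! ### The algorithm encodes the gradient descent iterate -/

section

variable {n d q : ℕ}

theorem totalWeight_eq (ω : Fin n → ℝ) (τ : ℕ → Fin q → Fin n) (k : ℕ) :
    totalWeight ω τ k = ∑ j : Fin q, ω (τ k j) / q := by
  unfold totalWeight batchWeight
  rw [Finset.sum_comm]
  simp

theorem batchWeight_nonneg {ω : Fin n → ℝ} (hω : ∀ i, 0 < ω i) (τ : ℕ → Fin q → Fin n) (k : ℕ)
    (i : Fin n) : 0 ≤ batchWeight ω τ k i :=
  Finset.sum_nonneg fun j _ => by
    split_ifs
    · exact div_nonneg (hω i).le (Nat.cast_nonneg _)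
    · exact le_rfl

theorem totalWeight_pos (hq : 1 ≤ q) {ω : Fin n → ℝ} (hω : ∀ i, 0 < ω i)
    (τ : ℕ → Fin q → Fin n) (k : ℕ) : 0 < totalWeight ω τ k := by
  rw [totalWeight_eq]
  have : Nonempty (Fin q) := ⟨⟨0, hq⟩⟩
  exact Finset.sum_pos (fun j _ => div_pos (hω _) (by exact_mod_cast hq)) Finset.univ_nonempty

theorem batchWeight_eq_zero (ω : Fin n → ℝ) (τ : ℕ → Fin q → Fin n) (k : ℕ) (i : Fin n)
    (hi : ∀ j, τ k j ≠ i) : batchWeight ω τ k i = 0 := by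
  simp [batchWeight, hi]

theorem idxAmp_sq (hq : 1 ≤ q) {ω : Fin n → ℝ} (hω : ∀ i, 0 < ω i) (τ : ℕ → Fin q → Fin n)
    (k : ℕ) (i : Fin n) :
    idxAmp ω τ k i * idxAmp ω τ k i = batchWeight ω τ k i / totalWeight ω τ k :=
  Real.mul_self_sqrt (div_nonneg (batchWeight_nonneg hω τ k i) (totalWeight_pos hq hω τ k).le)

theorem sum_idxAmp_sq (hq : 1 ≤ q) {ω : Fin n → ℝ} (hω : ∀ i, 0 < ω i)
    (τ : ℕ → Fin q → Fin n) (k : ℕ) : ∑ i, idxAmp ω τ k i * idxAmp ω τ k i = 1 := by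
  simp_rw [idxAmp_sq hq hω, ← Finset.sum_div]
  exact div_self (totalWeight_pos hq hω τ k).ne'

theorem one_le_algV (c : Fin n → ℝ) (τ : ℕ → Fin q → Fin n) : ∀ k, 1 ≤ algV c τ k
  | 0 => le_rfl
  | k + 1 => by
    rw [algV, Real.one_le_sqrt]
    nlinarith [one_le_algV c τ k, sq_nonneg (batchNorm c τ k)]

theorem algV_pos (c : Fin n → ℝ) (τ : ℕ → Fin q → Fin n) (k : ℕ) : 0 < algV c τ k :=
  zero_lt_one.trans_le (one_le_algV c τ k)

theorem algV_succ_sq (c : Fin n → ℝ) (τ : ℕ → Fin q → Fin n) (k : ℕ) :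
    algV c τ (k + 1) ^ 2 = algV c τ k ^ 2 + batchNorm c τ k ^ 2 := by
  rw [algV, Real.sq_sqrt (by positivity)]

/-- The gradient of f_i is (a_i x − b_i) a_i; both factors are proportional to ‖a_i‖, which cancels
the division by ‖a_i‖². Grouping the batch by rows collects repetitions into ω_{k,i}. -/
theorem sgd_succ_apply {a : Fin n → EuclideanSpace ℝ (Fin d)} {b c : Fin n → ℝ}
    (ω : Fin n → ℝ) (τ : ℕ → Fin q → Fin n) (x₀ : EuclideanSpace ℝ (Fin d))
    (ha : ∀ i, a i ≠ 0) (hc : ∀ i, c i = b i / ‖a i‖) (k : ℕ) (j : Fin d) :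
    sgd a b ω τ x₀ (k + 1) j = sgd a b ω τ x₀ k j +
      ∑ i, batchWeight ω τ k i *
        (c i - ∑ l, rowAmp a i l * sgd a b ω τ x₀ k l) * rowAmp a i j := by
  rw [sgd]
  set x := sgd a b ω τ x₀ k
  have hg : ∀ i, gradient (lossTerm a b i) x = (inner ℝ (a i) x - b i) • a i := fun i =>
    (hasGradientAt_lossTerm a b i x).gradient
  have hin : ∀ i, inner ℝ (a i) x = ‖a i‖ * ∑ l, rowAmp a i l * x l := by
    intro i
    have := norm_ne_zero_iff.mpr (ha i)
    rw [PiLp.inner_apply, Finset.mul_sum]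
    refine Finset.sum_congr rfl fun l _ => ?_
    simp only [rowAmp, RCLike.inner_apply, conj_trivial]
    field_simp
  have hb : ∀ i, b i = ‖a i‖ * c i := fun i => by
    have := norm_ne_zero_iff.mpr (ha i)
    rw [hc]; field_simp
  have haj : ∀ i, a i j = ‖a i‖ * rowAmp a i j := fun i => by
    have := norm_ne_zero_iff.mpr (ha i)
    rw [rowAmp]; field_simp
  simp only [hg, PiLp.sub_apply, PiLp.smul_apply, WithLp.ofLp_sum, Finset.sum_apply, smul_eq_mul,
    batchWeight, Finset.sum_mul]
  rw [Finset.sum_comm, sub_eq_add_neg, Finset.mul_sum, ← Finset.sum_neg_distrib]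
  congr 1
  refine Finset.sum_congr rfl fun m _ => ?_
  rw [Finset.sum_eq_single (τ k m) (fun i _ hi => by simp [Ne.symm hi]) (by simp)]
  have := norm_ne_zero_iff.mpr (ha (τ k m))
  simp only [if_true, hin, hb, haj]
  field_simp
  ring

theorem algSigma_mulVec (a : Fin n → EuclideanSpace ℝ (Fin d)) (ω : Fin n → ℝ)
    (τ : ℕ → Fin q → Fin n) (k : ℕ) (X : Fin n × Fin d → ℝ) (i : Fin n) (j : Fin d) :
    (algSigma a ω τ k).mulVec X (i, j) = if ∃ m, τ k m = i then
      totalWeight ω τ k * (∑ l, rowAmp a i l * X (i, l)) * rowAmp a i j else 0 := by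
  rw [algSigma, Matrix.smul_mulVec, Matrix.sum_mulVec]
  simp only [Pi.smul_apply, Finset.sum_apply, smul_eq_mul]
  have h : ∀ i', (Matrix.single i' i' (1 : ℝ) ⊗ₖ
      Matrix.vecMulVec (rowAmp a i') (rowAmp a i')).mulVec X (i, j) =
      if i' = i then (∑ l, rowAmp a i l * X (i, l)) * rowAmp a i j else 0 := by
    intro i'
    simp only [Matrix.mulVec, dotProduct, Fintype.sum_prod_type, Matrix.kroneckerMap_apply,
      Matrix.single_apply, Matrix.vecMulVec_apply]
    split_ifs with h
    · subst h
      rw [Finset.sum_eq_single i' (fun x _ hx => by simp [Ne.symm hx]) (by simp), Finset.sum_mul]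
      refine Finset.sum_congr rfl fun l _ => ?_
      simp; ring
    · simp [h]
  simp only [h, Finset.sum_ite_eq', Finset.mem_image, Finset.mem_univ, true_and]
  split_ifs <;> ring

theorem algZ_apply (a : Fin n → EuclideanSpace ℝ (Fin d)) (c ω : Fin n → ℝ)
    (τ : ℕ → Fin q → Fin n) (k : ℕ) (X : Fin n × Fin d → ℝ) (p : Fin n × Fin d) :
    algZ a c ω τ k X p = algY a c ω τ k X (0, p)
      - (algSigma a ω τ k).mulVec (fun p => algY a c ω τ k X (0, p)) p
      + (algSigma a ω τ k).mulVec (fun p => algY a c ω τ k X (1, p)) p := by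
  have h1 : (1 - algSigma a ω τ k).mulVec (fun p => algY a c ω τ k X (0, p)) p =
      algY a c ω τ k X (0, p) - (algSigma a ω τ k).mulVec (fun p => algY a c ω τ k X (0, p)) p := by
    rw [Matrix.sub_mulVec, Matrix.one_mulVec, Pi.sub_apply]
  rw [← h1, algZ, algU, Matrix.add_mulVec, Pi.add_apply]
  congr 1 <;> simp [Matrix.mulVec, dotProduct, Fintype.sum_prod_type, Matrix.kroneckerMap_apply]

theorem sum_rowAmp_sq {a : Fin n → EuclideanSpace ℝ (Fin d)} (ha : ∀ i, a i ≠ 0) (i : Fin n) :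
    ∑ l, rowAmp a i l * rowAmp a i l = 1 := by
  have := norm_ne_zero_iff.mpr (ha i)
  have h := EuclideanSpace.norm_sq_eq (a i)
  simp only [Real.norm_eq_abs, sq_abs] at h
  simp_rw [rowAmp, div_mul_div_comm, ← Finset.sum_div, ← pow_two]
  rw [← h]
  field_simp

/-- The factors β_k and γ_{k,i} put both the old iterate and the new data over the common
denominator v_{k+1}; applying ⟨s_k| then averages over the rows with weights s_{k,i}². -/
theorem algX_eq (hq : 1 ≤ q) {a : Fin n → EuclideanSpace ℝ (Fin d)} {b c ω : Fin n → ℝ}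
    (τ : ℕ → Fin q → Fin n) (x₀ : EuclideanSpace ℝ (Fin d)) (hω : ∀ i, 0 < ω i)
    (ha : ∀ i, a i ≠ 0) (hc : ∀ i, c i = b i / ‖a i‖) (k : ℕ) (i : Fin n) (j : Fin d) :
    algX a c ω τ x₀ k (i, j) = idxAmp ω τ k i * (sgd a b ω τ x₀ k j / algV c τ k) := by
  induction k generalizing i j with
  | zero => simp [algX, algV, sgd]
  | succ k ih =>
    have hv := (algV_pos c τ k).ne'
    have hv' := (algV_pos c τ (k + 1)).ne'
    have ht := (totalWeight_pos hq hω τ k).ne'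
    rw [algX]
    simp only
    congr 1
    set x := sgd a b ω τ x₀ k with hx
    have hY : ∀ i j, algY a c ω τ k (algX a c ω τ x₀ k) (0, (i, j)) =
        idxAmp ω τ k i * x j / algV c τ (k + 1) := by
      intro i j
      simp only [algY, if_true, ih]
      field_simp
    have hY1 : ∀ i j, algY a c ω τ k (algX a c ω τ x₀ k) (1, (i, j)) =
        idxAmp ω τ k i * c i * rowAmp a i j / algV c τ (k + 1) := by
      intro i j
      simp only [algY, one_ne_zero, if_false]
      field_simp
    have hS : ∀ i, (∑ l, rowAmp a i l * (idxAmp ω τ k i * x l / algV c τ (k + 1))) =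
        idxAmp ω τ k i * (∑ l, rowAmp a i l * x l) / algV c τ (k + 1) := by
      intro i
      rw [Finset.mul_sum, Finset.sum_div]
      exact Finset.sum_congr rfl fun l _ => by ring
    have hS1 : ∀ i, (∑ l, rowAmp a i l * (idxAmp ω τ k i * c i * rowAmp a i l /
        algV c τ (k + 1))) = idxAmp ω τ k i * c i / algV c τ (k + 1) := by
      intro i
      have h1 := sum_rowAmp_sq ha i
      calc _ = (∑ l, rowAmp a i l * rowAmp a i l) *
            (idxAmp ω τ k i * c i / algV c τ (k + 1)) := by
            rw [Finset.sum_mul]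
            exact Finset.sum_congr rfl fun l _ => by ring
        _ = _ := by rw [h1, one_mul]
    have hterm : ∀ i, idxAmp ω τ k i * algZ a c ω τ k (algX a c ω τ x₀ k) (i, j) =
        (idxAmp ω τ k i * idxAmp ω τ k i) * (x j / algV c τ (k + 1)) +
        (batchWeight ω τ k i * (c i - ∑ l, rowAmp a i l * x l) * rowAmp a i j) /
          algV c τ (k + 1) := by
      intro i
      rw [algZ_apply, algSigma_mulVec, algSigma_mulVec]
      simp only [hY, hY1, hS, hS1]
      split_ifs with hi
      -- The factor t_k in Σ_k undoes the normalization of s_k.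
      · have h2 : batchWeight ω τ k i = totalWeight ω τ k * (idxAmp ω τ k i * idxAmp ω τ k i) := by
          rw [idxAmp_sq hq hω]; field_simp
        rw [h2]
        ring
      · rw [batchWeight_eq_zero ω τ k i (by simpa using hi)]
        ring
    rw [algAdd]
    simp only [hterm]
    rw [Finset.sum_add_distrib, ← Finset.sum_mul, sum_idxAmp_sq hq hω, ← Finset.sum_div,
      sgd_succ_apply ω τ x₀ ha hc]
    ring

theorem algOutput_eq (hq : 1 ≤ q) {a : Fin n → EuclideanSpace ℝ (Fin d)} {b c ω : Fin n → ℝ}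
    (τ : ℕ → Fin q → Fin n) (x₀ : EuclideanSpace ℝ (Fin d)) (hω : ∀ i, 0 < ω i)
    (ha : ∀ i, a i ≠ 0) (hc : ∀ i, c i = b i / ‖a i‖) (K : ℕ) (j : Fin d) :
    algOutput a c ω τ x₀ K j = sgd a b ω τ x₀ K j / algV c τ K := by
  rw [algOutput, algAdd]
  simp only [algX_eq hq τ x₀ hω ha hc, ← mul_assoc, ← Finset.sum_mul, sum_idxAmp_sq hq hω, one_mul]

end

noncomputable section

/-! ## Gates and circuits -/

theorem Function.extend_trans_apply {α β γ δ : Type*} (e : β ↪ γ) (p : α ↪ β) (y : α → δ)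
    (x : γ → δ) :
    Function.extend (p.trans e) y x = Function.extend e (Function.extend p y (x ∘ e)) x := by
  ext w
  by_cases hw : ∃ v, e v = w
  · obtain ⟨v, rfl⟩ := hw
    rw [e.injective.extend_apply]
    by_cases hv : ∃ u, p u = v
    · obtain ⟨u, rfl⟩ := hv
      rw [p.injective.extend_apply]
      exact (p.trans e).injective.extend_apply _ _ u
    · rw [Function.extend_apply' _ _ _ hv, Function.extend_apply']
      · rfl
      · rintro ⟨u, hu⟩
        exact hv ⟨u, e.injective hu⟩
  · rw [Function.extend_apply' _ _ _ hw, Function.extend_apply']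
    rintro ⟨u, hu⟩
    exact hw ⟨p u, hu⟩

theorem Function.extend_comp_self {β γ δ : Type*} (e : β ↪ γ) (x : γ → δ) :
    Function.extend e (x ∘ e) x = x := by
  ext w
  by_cases hw : ∃ v, e v = w
  · obtain ⟨v, rfl⟩ := hw
    rw [e.injective.extend_apply]; rfl
  · rw [Function.extend_apply' _ _ _ hw]

theorem Function.extend_update_comp {β γ δ : Type*} [DecidableEq β] [DecidableEq γ] (e : β ↪ γ)
    (x : γ → δ) (t : β) (b : δ) :
    Function.update x (e t) b = Function.extend e (Function.update (x ∘ e) t b) x := by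
  ext w
  by_cases hw : ∃ v, e v = w
  · obtain ⟨v, rfl⟩ := hw
    rw [e.injective.extend_apply]
    by_cases hv : v = t
    · subst hv; simp
    · rw [Function.update_of_ne hv, Function.update_of_ne (e.injective.ne hv)]; rfl
  · rw [Function.extend_apply' _ _ _ hw, Function.update_of_ne]
    rintro rfl
    exact hw ⟨t, rfl⟩

theorem Function.extend_extend_same {β γ δ : Type*} (e : β ↪ γ) (y z : β → δ) (x : γ → δ) :
    Function.extend e y (Function.extend e z x) = Function.extend e y x := by
  ext w
  by_cases hw : ∃ v, e v = w
  · obtain ⟨v, rfl⟩ := hw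
    rw [e.injective.extend_apply, e.injective.extend_apply]
  · rw [Function.extend_apply' _ _ _ hw, Function.extend_apply' _ _ _ hw,
      Function.extend_apply' _ _ _ hw]

namespace Gate

variable {W W' Q : Type} {port : Q → Type}

/-- The same gate on a larger set of wires. -/
def map (e : W ↪ W') : Gate W Q port → Gate W' Q port
  | elementary u t cs hcard ht =>
      elementary u (e t) (cs.map e) (by rwa [Finset.card_map]) (by simpa using ht)
  | query o adj f cs hcard hf =>
      query o adj (f.trans e) (cs.map e) (by rwa [Finset.card_map]) (by simpa using hf)

theorem isQuery_map (e : W ↪ W') (g : Gate W Q port) : (g.map e).isQuery = g.isQuery := by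
  cases g <;> rfl

variable [DecidableEq W] [DecidableEq W'] [∀ o, Fintype (port o)] [∀ o, DecidableEq (port o)]
  (O : ∀ o, Matrix.unitaryGroup (port o → Bool) ℂ)

/-- A gate on few wires acts separately on each slice of the state obtained by freezing the other
wires. -/
theorem act_map (e : W ↪ W') (g : Gate W Q port) (ψ : (W' → Bool) → ℂ) (x : W' → Bool) :
    (g.map e).act O ψ x = g.act O (fun y => ψ (Function.extend e y x)) (x ∘ e) := by
  cases g with
  | elementary u t cs hcard ht =>
    simp only [map, act, Finset.forall_mem_map, Function.comp_apply,
      Function.extend_update_comp, Function.extend_comp_self]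
  | query o adj f cs hcard hf =>
    simp only [map, act, Finset.forall_mem_map, Function.comp_apply,
      Function.extend_trans_apply, Function.extend_comp_self, Function.Embedding.trans_apply]

theorem act_zero (g : Gate W Q port) : g.act O (fun _ => 0) = fun _ => 0 := by
  cases g <;> ext x <;> simp [act]

end Gate

namespace Circuit

variable {W W' Q : Type} {port : Q → Type}

/-- The same circuit on a larger set of wires. -/
def onWires (e : W ↪ W') (P : Circuit W Q port) : Circuit W' Q port := P.map (Gate.map e)

theorem queryCount_append (P P' : Circuit W Q port) :
    queryCount (P ++ P' : Circuit W Q port) = P.queryCount + P'.queryCount := List.countP_append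

theorem gateCount_append (P P' : Circuit W Q port) :
    gateCount (P ++ P' : Circuit W Q port) = P.gateCount + P'.gateCount := List.countP_append

theorem queryCount_onWires (e : W ↪ W') (P : Circuit W Q port) :
    (P.onWires e).queryCount = P.queryCount := by
  simp only [onWires, queryCount, List.countP_map, Function.comp_def, Gate.isQuery_map]

theorem gateCount_onWires (e : W ↪ W') (P : Circuit W Q port) :
    (P.onWires e).gateCount = P.gateCount := by
  simp only [onWires, gateCount, List.countP_map, Function.comp_def, Gate.isQuery_map]

variable [DecidableEq W] [DecidableEq W'] [∀ o, Fintype (port o)] [∀ o, DecidableEq (port o)]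
  (O : ∀ o, Matrix.unitaryGroup (port o → Bool) ℂ)

/-- Action of a circuit on a vector of amplitudes. -/
def act (P : Circuit W Q port) (ψ : (W → Bool) → ℂ) : (W → Bool) → ℂ :=
  P.foldl (fun ψ g => g.act O ψ) ψ

theorem act_nil (ψ : (W → Bool) → ℂ) : act O ([] : Circuit W Q port) ψ = ψ := rfl

theorem act_cons (g : Gate W Q port) (P : Circuit W Q port) (ψ : (W → Bool) → ℂ) :
    act O (g :: P : Circuit W Q port) ψ = P.act O (g.act O ψ) := rfl

theorem act_append (P P' : Circuit W Q port) (ψ : (W → Bool) → ℂ) :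
    act O (P ++ P' : Circuit W Q port) ψ = P'.act O (P.act O ψ) := List.foldl_append

theorem act_zero (P : Circuit W Q port) : P.act O (fun _ => 0) = fun _ => 0 := by
  induction P with
  | nil => rfl
  | cons g P ih => rw [act_cons, Gate.act_zero, ih]

theorem act_onWires (e : W ↪ W') (P : Circuit W Q port) (ψ : (W' → Bool) → ℂ) (x : W' → Bool) :
    (P.onWires e).act O ψ x = P.act O (fun y => ψ (Function.extend e y x)) (x ∘ e) := by
  induction P generalizing ψ with
  | nil => simp only [onWires, List.map_nil, act_nil, Function.extend_comp_self]
  | cons g P ih =>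
    change act O (onWires e P) ((g.map e).act O ψ) x = act O P (g.act O _) (x ∘ e)
    rw [ih]
    congr 1
    ext y
    have h : Function.extend e y x ∘ e = y := funext fun v => e.injective.extend_apply _ _ v
    simp only [Gate.act_map, Function.extend_extend_same, h]

end Circuit

/-! ## Elementary gates -/

/-- The rotation `|0⟩ ↦ c|0⟩ + s|1⟩`. -/
def planeRotation (c s : ℝ) (h : c ^ 2 + s ^ 2 = 1) : Matrix.unitaryGroup Bool ℂ :=
  ⟨Matrix.of fun x y => if x = y then (c : ℂ) else if x then (s : ℂ) else -(s : ℂ), by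
    have h' : (c : ℂ) * c + s * s = 1 := by
      rw [← pow_two, ← pow_two]; exact_mod_cast h
    have h'' : (s : ℂ) * s + c * c = 1 := by rw [add_comm, h']
    rw [Matrix.mem_unitaryGroup_iff]
    ext x y
    cases x <;> cases y <;>
      simp [Matrix.mul_apply, Matrix.star_apply, h', h'', mul_comm]⟩

/-- The Pauli NOT. -/
def pauliX : Matrix.unitaryGroup Bool ℂ :=
  ⟨Matrix.of fun x y => if x = y then 0 else 1, by
    rw [Matrix.mem_unitaryGroup_iff]
    ext x y
    cases x <;> cases y <;> simp [Matrix.mul_apply, Matrix.star_apply]⟩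

namespace Gate

variable {W Q : Type} {port : Q → Type} [DecidableEq W]

/-- The NOT gate. -/
def not (t : W) : Gate W Q port := elementary pauliX t ∅ (by simp) (by simp)

/-- The controlled NOT gate, for different wires `t` and `u`. -/
def cnot (t u : W) : Gate W Q port :=
  elementary pauliX t (({u} : Finset W).erase t)
    ((Finset.card_erase_le).trans (by simp)) (Finset.notMem_erase t _)

/-- The Toffoli gate with target `t`, different from `u` and `v`. -/
def toffoli (t u v : W) : Gate W Q port :=
  elementary pauliX t (({u, v} : Finset W).erase t)
    ((Finset.card_erase_le).trans Finset.card_le_two) (Finset.notMem_erase t _)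

variable [∀ o, Fintype (port o)] [∀ o, DecidableEq (port o)]
  (O : ∀ o, Matrix.unitaryGroup (port o → Bool) ℂ)

/-- A gate that permutes basis states acts on amplitudes by precomposition with the inverse
permutation. NOT, CNOT and Toffoli are involutions, so the inverse is invisible in each single gate;
for circuits it reverses the order. -/
theorem act_not (t : W) (ψ : (W → Bool) → ℂ) (x : W → Bool) :
    (not t : Gate W Q port).act O ψ x = ψ (Function.update x t (!x t)) := by
  cases h : x t <;> simp [not, act, pauliX, h]

theorem act_cnot {t u : W} (h : t ≠ u) (ψ : (W → Bool) → ℂ) (x : W → Bool) :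
    (cnot t u : Gate W Q port).act O ψ x = ψ (Function.update x t (x t ^^ x u)) := by
  have he : ({u} : Finset W).erase t = {u} := Finset.erase_eq_of_notMem (by simpa)
  simp only [cnot, act, he]
  cases h1 : x t <;> cases h2 : x u <;> simp [pauliX, h2] <;> simp [← h1]

theorem act_toffoli {t u v : W} (h : t ≠ u) (h' : t ≠ v) (ψ : (W → Bool) → ℂ) (x : W → Bool) :
    (toffoli t u v : Gate W Q port).act O ψ x =
      ψ (Function.update x t (x t ^^ (x u && x v))) := by
  have he : ({u, v} : Finset W).erase t = {u, v} :=
    Finset.erase_eq_of_notMem (by simp [h, h'])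
  simp only [toffoli, act, he]
  cases h1 : x t <;> cases h2 : x u <;> cases h3 : x v <;> simp [pauliX, h2, h3] <;>
    simp [← h1]

end Gate

end

noncomputable section

/-! ## Reversible evaluation of a predicate by a ladder of Toffoli gates -/

/-- One step of the bitwise comparison `x ≤ N` (least significant bit first): `acc` compares the
lower bits, `u` and `b` are the next bits of `x` and `N`. For `b = false` it is `acc ∧ ¬ u`. -/
def leStep (b acc u : Bool) : Bool := if b then acc || !u else acc && !u

namespace Ladder

variable {W Q : Type} {port : Q → Type} [DecidableEq W]

/-- The effect of a rung on basis states. -/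
def rungFun (a u t : W) (b : Bool) (x : W → Bool) : W → Bool :=
  Function.update x t (x t ^^ leStep b (x a) (x u))

/-- Add `leStep b a u` to the wire `t`. -/
def rung (a u t : W) : Bool → Circuit W Q port
  | true => [Gate.not t, Gate.cnot t u, Gate.toffoli t a u]
  | false => [Gate.cnot t a, Gate.toffoli t a u]

theorem rungFun_rungFun {a u t : W} (ha : t ≠ a) (hu : t ≠ u) (b : Bool) (x : W → Bool) :
    rungFun a u t b (rungFun a u t b x) = x := by
  simp [rungFun, Function.update_of_ne ha.symm, Function.update_of_ne hu.symm]

theorem rungFun_of_ne {a u t w : W} (h : w ≠ t) (b : Bool) (x : W → Bool) :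
    rungFun a u t b x w = x w := Function.update_of_ne h _ _

theorem rungFun_update {a u t f : W} (ha : f ≠ a) (hu : f ≠ u) (ht : f ≠ t) (b y : Bool)
    (x : W → Bool) :
    rungFun a u t b (Function.update x f y) = Function.update (rungFun a u t b x) f y := by
  simp only [rungFun, Function.update_of_ne ha.symm, Function.update_of_ne hu.symm,
    Function.update_of_ne ht.symm]
  exact Function.update_comm ht _ _ _

variable (anc : ℕ → W)

/-- Evaluate `leStep` along a list of wires, writing the partial results into `anc`. -/
def compute : List (W × Bool) → ℕ → Circuit W Q port
  | [], _ => []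
  | p :: l, k => rung (anc k) p.1 (anc (k + 1)) p.2 ++ compute l (k + 1)

/-- The inverse of `compute`. -/
def uncompute : List (W × Bool) → ℕ → Circuit W Q port
  | [], _ => []
  | p :: l, k => uncompute l (k + 1) ++ rung (anc k) p.1 (anc (k + 1)) p.2

/-- The effect of `compute` on basis states. -/
def fill : List (W × Bool) → ℕ → (W → Bool) → (W → Bool)
  | [], _, x => x
  | p :: l, k, x => fill l (k + 1) (rungFun (anc k) p.1 (anc (k + 1)) p.2 x)

/-- The inverse of `fill`. -/
def unfill : List (W × Bool) → ℕ → (W → Bool) → (W → Bool)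
  | [], _, x => x
  | p :: l, k, x => rungFun (anc k) p.1 (anc (k + 1)) p.2 (unfill l (k + 1) x)

/-- Flip `f` if the predicate evaluated along the list `l` holds. -/
def controlledNot (l : List (W × Bool)) (f : W) : Circuit W Q port :=
  [Gate.not (anc 0)] ++ compute anc l 0 ++ [Gate.cnot f (anc l.length)] ++ uncompute anc l 0 ++
    [Gate.not (anc 0)]

theorem gateCount_rung (a u t : W) (b : Bool) :
    (rung a u t b : Circuit W Q port).gateCount ≤ 3 := by
  cases b <;> simp [rung, Circuit.gateCount, Gate.not, Gate.cnot, Gate.toffoli, Gate.isQuery]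

theorem queryCount_rung (a u t : W) (b : Bool) :
    (rung a u t b : Circuit W Q port).queryCount = 0 := by
  cases b <;> simp [rung, Circuit.queryCount, Gate.not, Gate.cnot, Gate.toffoli, Gate.isQuery]

theorem gateCount_compute (l : List (W × Bool)) (k : ℕ) :
    (compute anc l k : Circuit W Q port).gateCount ≤ 3 * l.length := by
  induction l generalizing k with
  | nil => simp [compute, Circuit.gateCount]
  | cons p l ih =>
    rw [compute, Circuit.gateCount_append, List.length_cons]
    have := ih (k + 1)
    have := gateCount_rung (Q := Q) (port := port) (anc k) p.1 (anc (k + 1)) p.2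
    omega

theorem gateCount_uncompute (l : List (W × Bool)) (k : ℕ) :
    (uncompute anc l k : Circuit W Q port).gateCount ≤ 3 * l.length := by
  induction l generalizing k with
  | nil => simp [uncompute, Circuit.gateCount]
  | cons p l ih =>
    rw [uncompute, Circuit.gateCount_append, List.length_cons]
    have := ih (k + 1)
    have := gateCount_rung (Q := Q) (port := port) (anc k) p.1 (anc (k + 1)) p.2
    omega

theorem queryCount_compute (l : List (W × Bool)) (k : ℕ) :
    (compute anc l k : Circuit W Q port).queryCount = 0 := by
  induction l generalizing k with
  | nil => simp [compute, Circuit.queryCount]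
  | cons p l ih => rw [compute, Circuit.queryCount_append, queryCount_rung, ih]

theorem queryCount_uncompute (l : List (W × Bool)) (k : ℕ) :
    (uncompute anc l k : Circuit W Q port).queryCount = 0 := by
  induction l generalizing k with
  | nil => simp [uncompute, Circuit.queryCount]
  | cons p l ih => rw [uncompute, Circuit.queryCount_append, queryCount_rung, ih]

theorem gateCount_controlledNot (l : List (W × Bool)) (f : W) :
    (controlledNot anc l f : Circuit W Q port).gateCount ≤ 6 * l.length + 3 := by
  have h1 := gateCount_compute (Q := Q) (port := port) anc l 0
  have h2 := gateCount_uncompute (Q := Q) (port := port) anc l 0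
  have h3 : Circuit.gateCount ([Gate.not (anc 0)] : Circuit W Q port) = 1 := rfl
  have h4 : Circuit.gateCount ([Gate.cnot f (anc l.length)] : Circuit W Q port) = 1 := rfl
  simp only [controlledNot, Circuit.gateCount_append, h3, h4]
  omega

theorem queryCount_controlledNot (l : List (W × Bool)) (f : W) :
    (controlledNot anc l f : Circuit W Q port).queryCount = 0 := by
  simp only [controlledNot, Circuit.queryCount_append, queryCount_compute, queryCount_uncompute]
  rfl

/-- Injectivity of `anc` is required only up to `M`, because the ladder used later has finitely many
wires and its numbering wraps around. -/
theorem unfill_fill {anc : ℕ → W} {M : ℕ}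
    (hanc : ∀ i j, i ≤ M → j ≤ M → anc i = anc j → i = j) (l : List (W × Bool)) (k : ℕ)
    (hk : k + l.length ≤ M) (hl : ∀ p ∈ l, ∀ j, p.1 ≠ anc j) (x : W → Bool) :
    unfill anc l k (fill anc l k x) = x := by
  induction l generalizing k x with
  | nil => rfl
  | cons p l ih =>
    rw [List.length_cons] at hk
    rw [fill, unfill, ih (k + 1) (by omega) fun p hp => hl p (List.mem_cons_of_mem _ hp)]
    refine rungFun_rungFun (fun h => ?_) (hl p List.mem_cons_self _).symm _ _
    have := hanc _ _ (by omega) (by omega) h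
    omega

theorem fill_update {anc : ℕ → W} {f : W} (l : List (W × Bool)) (k : ℕ)
    (hf : ∀ j, f ≠ anc j) (hl : ∀ p ∈ l, f ≠ p.1) (x : W → Bool) (y : Bool) :
    fill anc l k (Function.update x f y) = Function.update (fill anc l k x) f y := by
  induction l generalizing k x with
  | nil => rfl
  | cons p l ih =>
    rw [fill, rungFun_update (hf _) (hl p List.mem_cons_self) (hf _),
      ih (k + 1) fun p hp => hl p (List.mem_cons_of_mem _ hp), fill]

/-- On an empty ladder each rung writes the next partial result into its own wire, so the last wire
holds the whole fold. -/
theorem fill_apply {anc : ℕ → W} {M : ℕ}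
    (hanc : ∀ i j, i ≤ M → j ≤ M → anc i = anc j → i = j) (l : List (W × Bool)) (k : ℕ)
    (hk : k + l.length ≤ M) (hl : ∀ p ∈ l, ∀ j, p.1 ≠ anc j) (x : W → Bool)
    (hx : ∀ j, k < j → j ≤ M → x (anc j) = false) :
    fill anc l k x (anc (k + l.length)) =
      l.foldl (fun acc p => leStep p.2 acc (x p.1)) (x (anc k)) := by
  induction l generalizing k x with
  | nil => rfl
  | cons p l ih =>
    rw [List.length_cons] at hk
    have hl' : ∀ p ∈ l, ∀ j, p.1 ≠ anc j := fun p hp => hl p (List.mem_cons_of_mem _ hp)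
    rw [fill, List.length_cons, show k + (l.length + 1) = k + 1 + l.length by omega,
      ih (k + 1) (by omega) hl', List.foldl_cons]
    · rw [show rungFun (anc k) p.1 (anc (k + 1)) p.2 x (anc (k + 1)) =
          leStep p.2 (x (anc k)) (x p.1) by simp [rungFun, hx (k + 1) (by omega) (by omega)]]
      refine List.foldl_ext _ _ _ fun acc p' hp' => ?_
      rw [rungFun_of_ne (hl' p' hp' _)]
    · intro j hj hjM
      rw [rungFun_of_ne, hx j (by omega) hjM]
      intro h
      have := hanc _ _ hjM (by omega) h
      omega

theorem fill_of_ne {anc : ℕ → W} {w : W} (l : List (W × Bool)) (k : ℕ) (hw : ∀ j, w ≠ anc j)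
    (x : W → Bool) : fill anc l k x w = x w := by
  induction l generalizing k x with
  | nil => rfl
  | cons p l ih => rw [fill, ih, rungFun_of_ne (hw _)]

variable [∀ o, Fintype (port o)] [∀ o, DecidableEq (port o)]
  (O : ∀ o, Matrix.unitaryGroup (port o → Bool) ℂ)

theorem act_rung {a u t : W} (ha : t ≠ a) (hu : t ≠ u) (b : Bool) (ψ : (W → Bool) → ℂ)
    (x : W → Bool) : (rung a u t b : Circuit W Q port).act O ψ x = ψ (rungFun a u t b x) := by
  cases b
  · simp only [rung, Circuit.act_cons, Circuit.act_nil, Gate.act_toffoli O ha hu,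
      Gate.act_cnot O ha, rungFun, leStep, Function.update_idem, Function.update_self,
      Function.update_of_ne ha.symm]
    congr 2
    cases x t <;> cases x a <;> cases x u <;> rfl
  · simp only [rung, Circuit.act_cons, Circuit.act_nil, Gate.act_toffoli O ha hu,
      Gate.act_cnot O hu, Gate.act_not, rungFun, leStep, Function.update_idem,
      Function.update_self, Function.update_of_ne hu.symm]
    congr 2
    cases x t <;> cases x a <;> cases x u <;> rfl

/-- Precomposition reverses the order of the rungs, hence the inverse map here and the direct one
for `uncompute`. -/
theorem act_compute {anc : ℕ → W} {M : ℕ}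
    (hanc : ∀ i j, i ≤ M → j ≤ M → anc i = anc j → i = j) (l : List (W × Bool)) (k : ℕ)
    (hk : k + l.length ≤ M) (hl : ∀ p ∈ l, ∀ j, p.1 ≠ anc j) (ψ : (W → Bool) → ℂ)
    (x : W → Bool) :
    (compute anc l k : Circuit W Q port).act O ψ x = ψ (unfill anc l k x) := by
  induction l generalizing k ψ with
  | nil => rfl
  | cons p l ih =>
    rw [List.length_cons] at hk
    rw [compute, Circuit.act_append, ih (k + 1) (by omega) fun p hp => hl p
      (List.mem_cons_of_mem _ hp), act_rung O (fun h => ?_) (hl p List.mem_cons_self _).symm,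
      unfill]
    have := hanc _ _ (by omega) (by omega) h
    omega

theorem act_uncompute {anc : ℕ → W} {M : ℕ}
    (hanc : ∀ i j, i ≤ M → j ≤ M → anc i = anc j → i = j) (l : List (W × Bool)) (k : ℕ)
    (hk : k + l.length ≤ M) (hl : ∀ p ∈ l, ∀ j, p.1 ≠ anc j) (ψ : (W → Bool) → ℂ)
    (x : W → Bool) :
    (uncompute anc l k : Circuit W Q port).act O ψ x = ψ (fill anc l k x) := by
  induction l generalizing k x with
  | nil => rfl
  | cons p l ih =>
    rw [List.length_cons] at hk
    rw [uncompute, Circuit.act_append, act_rung O (fun h => ?_) (hl p List.mem_cons_self _).symm,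
      ih (k + 1) (by omega) fun p hp => hl p (List.mem_cons_of_mem _ hp), fill]
    have := hanc _ _ (by omega) (by omega) h
    omega

/-- The first NOT starts the fold with `true`. The flip of `f` commutes with filling the ladder,
which neither reads nor writes `f`; so uncomputing restores every ladder wire. -/
theorem act_controlledNot {anc : ℕ → W} {f : W} (l : List (W × Bool))
    (hanc : ∀ i j, i ≤ l.length → j ≤ l.length → anc i = anc j → i = j)
    (hl : ∀ p ∈ l, ∀ j, p.1 ≠ anc j) (hf : ∀ j, f ≠ anc j) (hfl : ∀ p ∈ l, f ≠ p.1)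
    (ψ : (W → Bool) → ℂ) (x : W → Bool) (hx : ∀ j, x (anc j) = false) :
    (controlledNot anc l f : Circuit W Q port).act O ψ x =
      ψ (Function.update x f
        (x f ^^ l.foldl (fun acc p => leStep p.2 acc (x p.1)) true)) := by
  have hk : 0 + l.length ≤ l.length := by omega
  simp only [controlledNot, Circuit.act_append, Circuit.act_cons, Circuit.act_nil, Gate.act_not]
  rw [act_uncompute O hanc l 0 hk hl, Gate.act_cnot O (hf _), act_compute O hanc l 0 hk hl,
    Gate.act_not]
  set x' := Function.update x (anc 0) (!x (anc 0)) with hx'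
  have h1 : fill anc l 0 x' (anc l.length) =
      l.foldl (fun acc p => leStep p.2 acc (x p.1)) true := by
    have := fill_apply hanc l 0 hk hl x' fun j hj hjM => by
      rw [hx', Function.update_of_ne, hx]
      intro h
      have := hanc _ _ hjM (by omega) h
      omega
    rw [zero_add] at this
    rw [this, hx', Function.update_self, hx]
    refine List.foldl_ext _ _ _ fun acc p hp => ?_
    rw [Function.update_of_ne (hl p hp _)]
  rw [h1, ← fill_update l 0 hf hfl, unfill_fill hanc l 0 hk hl, fill_of_ne l 0 hf, hx',
    Function.update_of_ne (hf 0)]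
  congr 1
  ext w
  by_cases hw : w = anc 0
  · subst hw
    simp [Function.update_of_ne (hf 0).symm]
  · by_cases hwf : w = f
    · subst hwf
      simp [hw]
    · simp [hw, hwf]

end Ladder

/-! ### Which predicates the ladder evaluates -/

theorem foldl_leStep_false {W : Type} (l : List W) (x : W → Bool) (acc : Bool) :
    l.foldl (fun acc u => leStep false acc (x u)) acc = (acc && l.all fun u => !x u) := by
  induction l generalizing acc with
  | nil => simp
  | cons u l ih =>
    rw [List.foldl_cons, ih, List.all_cons, ← Bool.and_assoc]
    rfl

/-- Induction on the number of bits: the new leading bit decides the comparison, and a tie leaves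
the verdict of the lower bits. -/
theorem foldl_leStep_testBit (N M p : ℕ) :
    (List.finRange p).foldl (fun acc (t : Fin p) => leStep (N.testBit t) acc (M.testBit t)) true =
      decide (M % 2 ^ p ≤ N % 2 ^ p) := by
  induction p with
  | zero => simp [Nat.mod_one]
  | succ p ih =>
    rw [List.finRange_succ_last, List.foldl_append, List.foldl_map]
    simp only [Fin.val_castSucc, List.foldl_cons, List.foldl_nil, Fin.val_last]
    rw [ih, Nat.mod_pow_succ, Nat.mod_pow_succ, Nat.testBit_eq_decide_div_mod_eq,
      Nat.testBit_eq_decide_div_mod_eq]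
    have h1 : M % 2 ^ p < 2 ^ p := Nat.mod_lt _ (by positivity)
    have h2 : N % 2 ^ p < 2 ^ p := Nat.mod_lt _ (by positivity)
    rcases Nat.mod_two_eq_zero_or_one (N / 2 ^ p) with h3 | h3 <;>
      rcases Nat.mod_two_eq_zero_or_one (M / 2 ^ p) with h4 | h4 <;>
      simp [leStep, h3, h4] <;> omega

theorem enc_injective {N : ℕ} : Function.Injective (enc : Fin N → Fin (qubits N) → Bool) := by
  intro i j h
  refine Fin.ext (Nat.eq_of_testBit_eq fun t => ?_)
  by_cases ht : t < qubits N
  · exact congrFun h ⟨t, ht⟩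
  · have hN : N ≤ 2 ^ qubits N := Nat.le_pow_clog one_lt_two N
    have h2 : 2 ^ qubits N ≤ 2 ^ t := Nat.pow_le_pow_right two_pos (by omega)
    rw [Nat.testBit_lt_two_pow (by omega), Nat.testBit_lt_two_pow (by omega)]

/-- The comparison is non-strict, so i < n is tested as i ≤ n − 1; this bound fits into the register
even if n is a power of two. -/
theorem foldl_leStep_enc {n : ℕ} (hn : 0 < n) (y : Fin (qubits n) → Bool) :
    (List.finRange (qubits n)).foldl (fun acc (t : Fin (qubits n)) => leStep ((n - 1).testBit t) acc (y t)) true =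
      true ↔ ∃ j : Fin n, y = enc j := by
  have hN : n ≤ 2 ^ qubits n := Nat.le_pow_clog one_lt_two n
  have hy : ∀ t : Fin (qubits n), y t = (Nat.ofBits y).testBit t := fun t => by simp
  simp_rw [hy]
  rw [foldl_leStep_testBit, decide_eq_true_iff, Nat.mod_eq_of_lt (Nat.ofBits_lt_two_pow y),
    Nat.mod_eq_of_lt (by omega)]
  constructor
  · intro h
    exact ⟨⟨Nat.ofBits y, by omega⟩, funext hy⟩
  · rintro ⟨j, hj⟩
    have : Nat.ofBits y = j := by
      refine Nat.eq_of_testBit_eq fun t => ?_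
      by_cases ht : t < qubits n
      · rw [← hy ⟨t, ht⟩, hj]; rfl
      · have h2 : 2 ^ qubits n ≤ 2 ^ t := Nat.pow_le_pow_right two_pos (by omega)
        have := Nat.ofBits_lt_two_pow y
        rw [Nat.testBit_lt_two_pow (by omega), Nat.testBit_lt_two_pow (by omega)]
    omega

end

noncomputable section

/-! ## Wires of the circuit -/

/-- The qubits used by one iteration only: an index register, the redundancy qubit of the weight
state, the qubit rotated according to the right-hand side, the flag, and a ladder of partial
results for the controlled NOT on the flag. -/
inductive Ancilla (p L : ℕ) : Type where
  | idx (t : Fin p) : Ancilla p L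
  | red : Ancilla p L
  | rhs : Ancilla p L
  | flag : Ancilla p L
  | lad (t : Fin (L + 1)) : Ancilla p L
  deriving DecidableEq, Fintype

/-- The work register, a qubit that is `1` in the part of the state which waits for being loaded,
and the ancillas of the iterations `k : κ`. -/
inductive Wire (p s L : ℕ) (κ : Type) : Type where
  | work (t : Fin s) : Wire p s L κ
  | mode : Wire p s L κ
  | anc (k : κ) (a : Ancilla p L) : Wire p s L κ
  deriving DecidableEq, Fintype

namespace Wire

variable {p s L : ℕ} {κ : Type}

/-- The wires of a single iteration. -/
def single (k : κ) : Wire p s L Unit ↪ Wire p s L κ where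
  toFun
    | work t => work t
    | mode => mode
    | anc _ a => anc k a
  inj' := by
    rintro (_ | _ | _) (_ | _ | _) <;> simp

/-- The work register. -/
def workEmb : Fin s ↪ Wire p s L κ := ⟨work, fun _ _ h => by simpa using h⟩

/-- The index register and the work register. -/
def rowPort (k : κ) : Fin p ⊕ Fin s ↪ Wire p s L κ where
  toFun := Sum.elim (fun t => anc k (.idx t)) work
  inj' := by rintro (_ | _) (_ | _) <;> simp

/-- The index register and the redundancy qubit. -/
def weightPort (k : κ) : Fin p ⊕ Unit ↪ Wire p s L κ where
  toFun := Sum.elim (fun t => anc k (.idx t)) fun _ => anc k .red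
  inj' := by rintro (_ | _) (_ | _) <;> simp

/-- The index register and the qubit rotated according to the right-hand side. -/
def rhsPort (k : κ) : Fin p ⊕ Unit ↪ Wire p s L κ where
  toFun := Sum.elim (fun t => anc k (.idx t)) fun _ => anc k .rhs
  inj' := by rintro (_ | _) (_ | _) <;> simp

theorem rowPort_ne_flag (k : κ) (u : Fin p ⊕ Fin s) :
    (rowPort k u : Wire p s L κ) ≠ anc k .flag := by
  rcases u with _ | _ <;> exact fun h => by cases h

theorem rhsPort_ne_flag (k : κ) (u : Fin p ⊕ Unit) :
    (rhsPort k u : Wire p s L κ) ≠ anc k .flag := by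
  rcases u with _ | _ <;> exact fun h => by cases h

/-- The basis state with given contents of the registers and an empty ladder. -/
def cfg (w : Fin s → Bool) (m : Bool) (i : Fin p → Bool) (r z f : Bool) : Wire p s L κ → Bool
  | work t => w t
  | mode => m
  | anc _ (.idx t) => i t
  | anc _ .red => r
  | anc _ .rhs => z
  | anc _ .flag => f
  | anc _ (.lad _) => false

theorem extend_eq {α β δ : Type*} (e : α ↪ β) (y : α → δ) (x g : β → δ)
    (h1 : ∀ u, g (e u) = y u) (h2 : ∀ v, (∀ u, e u ≠ v) → g v = x v) :
    Function.extend e y x = g := by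
  ext v
  by_cases hv : ∃ u, e u = v
  · obtain ⟨u, rfl⟩ := hv
    rw [e.injective.extend_apply, h1]
  · rw [Function.extend_apply' _ _ _ hv, h2]
    simpa using hv

variable (w w' : Fin s → Bool) (m : Bool) (i i' : Fin p → Bool) (r r' z z' f b : Bool)

theorem update_flag : Function.update (cfg w m i r z f : Wire p s L Unit → Bool)
    (anc () .flag) b = cfg w m i r z b := by
  ext v
  rcases v with _ | _ | ⟨_, _ | _ | _ | _ | _⟩ <;> simp [cfg]

theorem update_mode : Function.update (cfg w m i r z f : Wire p s L Unit → Bool) mode b =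
    cfg w b i r z f := by
  ext v
  rcases v with _ | _ | ⟨_, _ | _ | _ | _ | _⟩ <;> simp [cfg]

theorem extend_rowPort : Function.extend (rowPort ()) (Sum.elim i' w')
    (cfg w m i r z f : Wire p s L Unit → Bool) = cfg w' m i' r z f := by
  refine extend_eq _ _ _ _ ?_ ?_
  · rintro (_ | _) <;> rfl
  · rintro (t | _ | ⟨_, t | _ | _ | _ | _⟩) h <;> simp [cfg]
    · exact absurd rfl (h (Sum.inr t))
    · exact absurd rfl (h (Sum.inl t))

theorem extend_weightPort : Function.extend (weightPort ()) (Sum.elim i' fun _ => r')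
    (cfg w m i r z f : Wire p s L Unit → Bool) = cfg w m i' r' z f := by
  refine extend_eq _ _ _ _ ?_ ?_
  · rintro (_ | _) <;> rfl
  · rintro (t | _ | ⟨_, t | _ | _ | _ | _⟩) h <;> simp [cfg]
    · exact absurd rfl (h (Sum.inl t))
    · exact absurd rfl (h (Sum.inr ()))

theorem extend_rhsPort : Function.extend (rhsPort ()) (Sum.elim i' fun _ => z')
    (cfg w m i r z f : Wire p s L Unit → Bool) = cfg w m i' r z' f := by
  refine extend_eq _ _ _ _ ?_ ?_
  · rintro (_ | _) <;> rfl
  · rintro (t | _ | ⟨_, t | _ | _ | _ | _⟩) h <;> simp [cfg]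
    · exact absurd rfl (h (Sum.inl t))
    · exact absurd rfl (h (Sum.inr ()))

theorem cfg_rowPort : (fun u => (cfg w m i r z f : Wire p s L Unit → Bool) (rowPort () u)) =
    Sum.elim i w := by
  ext (_ | _) <;> rfl

theorem cfg_weightPort : (fun u => (cfg w m i r z f : Wire p s L Unit → Bool)
    (weightPort () u)) = Sum.elim i fun _ => r := by
  ext (_ | _) <;> rfl

theorem cfg_rhsPort : (fun u => (cfg w m i r z f : Wire p s L Unit → Bool) (rhsPort () u)) =
    Sum.elim i fun _ => z := by
  ext (_ | _) <;> rfl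

end Wire

theorem Gate.act_query_of_forall {W Q : Type} {port : Q → Type} [DecidableEq W]
    [∀ o, Fintype (port o)] [∀ o, DecidableEq (port o)]
    (O : ∀ o, Matrix.unitaryGroup (port o → Bool) ℂ) {o : Q} {adj : Bool} {e : port o ↪ W}
    {cs : Finset W} {hcard : cs.card ≤ 1} {hwires : ∀ p, e p ∉ cs} (ψ : (W → Bool) → ℂ)
    {x : W → Bool} (hx : ∀ w ∈ cs, x w = true) :
    (query o adj e cs hcard hwires).act O ψ x =
      ∑ y : port o → Bool,
        (if adj then star (O o : Matrix (port o → Bool) (port o → Bool) ℂ)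
          else (O o : Matrix (port o → Bool) (port o → Bool) ℂ)) (fun p => x (e p)) y *
            ψ (Function.extend e y x) :=
  if_pos hx

theorem Gate.act_query_of_not_forall {W Q : Type} {port : Q → Type} [DecidableEq W]
    [∀ o, Fintype (port o)] [∀ o, DecidableEq (port o)]
    (O : ∀ o, Matrix.unitaryGroup (port o → Bool) ℂ) {o : Q} {adj : Bool} {e : port o ↪ W}
    {cs : Finset W} {hcard : cs.card ≤ 1} {hwires : ∀ p, e p ∉ cs} (ψ : (W → Bool) → ℂ)
    {x : W → Bool} (hx : ¬ ∀ w ∈ cs, x w = true) :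
    (query o adj e cs hcard hwires).act O ψ x = ψ x :=
  if_neg hx

theorem sum_sumArrow {α β M : Type*} [AddCommMonoid M] [Fintype (α → Bool)] [Fintype (β → Bool)]
    [Fintype (α ⊕ β → Bool)] (F : (α ⊕ β → Bool) → M) :
    ∑ y, F y = ∑ u : α → Bool, ∑ v : β → Bool, F (Sum.elim u v) := by
  rw [← Fintype.sum_prod_type' fun u v => F (Sum.elim u v)]
  refine Fintype.sum_equiv (Equiv.sumArrowEquivProdArrow α β Bool) _ _ fun y => ?_
  congr 1
  ext (_ | _) <;> rfl

theorem sum_sumArrow_unit {α M : Type*} [AddCommMonoid M] [Fintype (α → Bool)]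
    [Fintype (α ⊕ Unit → Bool)] (F : (α ⊕ Unit → Bool) → M) :
    ∑ y, F y = ∑ u : α → Bool, ∑ b : Bool, F (Sum.elim u fun _ => b) := by
  rw [sum_sumArrow]
  refine Finset.sum_congr rfl fun u _ => ?_
  exact Fintype.sum_equiv (Equiv.funUnique Unit Bool) _ _ fun v => rfl

/-! ## Queries on the wires of one iteration -/

section Queries

variable {n d L : ℕ} (O : ∀ o, Matrix.unitaryGroup (memPort n d o → Bool) ℂ)
  (ψ : (Wire (qubits n) (qubits d) L Unit → Bool) → ℂ)
  (w : Fin (qubits d) → Bool) (m : Bool) (i : Fin (qubits n) → Bool) (r z f : Bool)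

open Wire

/-- The weight loader or its adjoint. -/
def weightQuery (k : ℕ) (adj : Bool) : Gate (Wire (qubits n) (qubits d) L Unit) Mem (memPort n d) :=
  .query (.weight k) adj (weightPort ()) ∅ (by simp) (by simp)

/-- The rotation that holds the right-hand side, controlled by the flag. -/
def rhsQuery (k : ℕ) : Gate (Wire (qubits n) (qubits d) L Unit) Mem (memPort n d) :=
  .query (.rhs k) false (rhsPort ()) {.anc () .flag} (by simp)
    fun u => Finset.notMem_singleton.mpr (rhsPort_ne_flag () u)

/-- The row read-out. -/
def rowQuery : Gate (Wire (qubits n) (qubits d) L Unit) Mem (memPort n d) :=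
  .query .row false (rowPort ()) ∅ (by simp) (by simp)

/-- The adjoint of the row read-out, controlled by the flag. -/
def rowAdjQuery : Gate (Wire (qubits n) (qubits d) L Unit) Mem (memPort n d) :=
  .query .row true (rowPort ()) {.anc () .flag} (by simp)
    fun u => Finset.notMem_singleton.mpr (rowPort_ne_flag () u)

theorem act_weightQuery (k : ℕ) : (weightQuery k false).act O ψ (cfg w m i r z f) =
    ∑ i', ∑ r', (O (.weight k)).1 (Sum.elim i fun _ => r) (Sum.elim i' fun _ => r') *
      ψ (cfg w m i' r' z f) := by
  refine (Gate.act_query_of_forall O ψ (by simp)).trans ?_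
  refine (sum_sumArrow_unit (α := Fin (qubits n)) _).trans ?_
  refine Finset.sum_congr rfl fun i' _ => Finset.sum_congr rfl fun r' _ => ?_
  rw [← extend_weightPort w m i i' r r' z f, ← cfg_weightPort w m i r z f]
  rfl

theorem act_weightQuery_adj (k : ℕ) : (weightQuery k true).act O ψ (cfg w m i r z f) =
    ∑ i', ∑ r', star ((O (.weight k)).1 (Sum.elim i' fun _ => r') (Sum.elim i fun _ => r)) *
      ψ (cfg w m i' r' z f) := by
  refine (Gate.act_query_of_forall O ψ (by simp)).trans ?_
  refine (sum_sumArrow_unit (α := Fin (qubits n)) _).trans ?_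
  refine Finset.sum_congr rfl fun i' _ => Finset.sum_congr rfl fun r' _ => ?_
  rw [← extend_weightPort w m i i' r r' z f, ← cfg_weightPort w m i r z f]
  rfl

theorem act_rhsQuery (k : ℕ) : (rhsQuery k).act O ψ (cfg w m i r z true) =
    ∑ i', ∑ z', (O (.rhs k)).1 (Sum.elim i fun _ => z) (Sum.elim i' fun _ => z') *
      ψ (cfg w m i' r z' true) := by
  refine (Gate.act_query_of_forall O ψ (by simp [cfg])).trans ?_
  refine (sum_sumArrow_unit (α := Fin (qubits n)) _).trans ?_
  refine Finset.sum_congr rfl fun i' _ => Finset.sum_congr rfl fun z' _ => ?_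
  rw [← extend_rhsPort w m i i' r z z' true, ← cfg_rhsPort w m i r z true]
  rfl

theorem act_rhsQuery_false (k : ℕ) : (rhsQuery k).act O ψ (cfg w m i r z false) =
    ψ (cfg w m i r z false) := by
  exact Gate.act_query_of_not_forall O ψ (by simp [cfg])

theorem act_rowQuery : rowQuery.act O ψ (cfg w m i r z f) =
    ∑ i', ∑ w', (O .row).1 (Sum.elim i w) (Sum.elim i' w') * ψ (cfg w' m i' r z f) := by
  refine (Gate.act_query_of_forall O ψ (by simp)).trans ?_
  refine (sum_sumArrow (α := Fin (qubits n)) (β := Fin (qubits d)) _).trans ?_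
  refine Finset.sum_congr rfl fun i' _ => Finset.sum_congr rfl fun w' _ => ?_
  rw [← extend_rowPort w w' m i i' r z f, ← cfg_rowPort w m i r z f]
  rfl

theorem act_rowAdjQuery : rowAdjQuery.act O ψ (cfg w m i r z true) =
    ∑ i', ∑ w', star ((O .row).1 (Sum.elim i' w') (Sum.elim i w)) *
      ψ (cfg w' m i' r z true) := by
  refine (Gate.act_query_of_forall O ψ (by simp [cfg])).trans ?_
  refine (sum_sumArrow (α := Fin (qubits n)) (β := Fin (qubits d)) _).trans ?_
  refine Finset.sum_congr rfl fun i' _ => Finset.sum_congr rfl fun w' _ => ?_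
  rw [← extend_rowPort w w' m i i' r z true, ← cfg_rowPort w m i r z true]
  rfl

theorem act_rowAdjQuery_false : rowAdjQuery.act O ψ (cfg w m i r z false) =
    ψ (cfg w m i r z false) := by
  exact Gate.act_query_of_not_forall O ψ (by simp [cfg])

theorem act_not_flag : (Gate.not (.anc () .flag) : Gate _ Mem (memPort n d)).act O ψ
    (cfg w m i r z f) = ψ (cfg w m i r z !f) := by
  rw [Gate.act_not, update_flag]
  rfl

theorem act_cnot_mode : (Gate.cnot .mode (.anc () .flag) : Gate _ Mem (memPort n d)).act O ψ
    (cfg w m i r z f) = ψ (cfg w (m ^^ f) i r z f) := by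
  rw [Gate.act_cnot O (by simp), update_mode]
  rfl

end Queries

/-! ## Unitarity in coordinates -/

section Unitarity

variable {n d : ℕ} (O : ∀ o, Matrix.unitaryGroup (memPort n d o → Bool) ℂ)

/-- The redundant part of the weight state is unknown, but unitarity fixes its total weight. This
makes G_k† G_k act as the identity on the part of the state that is left alone. -/
theorem weight_column_norm (k : ℕ) :
    ∑ i : Fin (qubits n) → Bool, ∑ r : Bool,
      star ((O (.weight k)).1 (Sum.elim i fun _ => r) (fun _ => false)) *
        (O (.weight k)).1 (Sum.elim i fun _ => r) (fun _ => false) = 1 := by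
  have h := congrFun (congrFun (Matrix.mem_unitaryGroup_iff'.mp (O (.weight k)).2)
    (fun _ => false)) (fun _ => false)
  rw [Matrix.mul_apply, Matrix.one_apply_eq] at h
  rw [← h]
  symm
  refine (sum_sumArrow_unit (α := Fin (qubits n)) (M := ℂ) _).trans ?_
  rfl

/-- V is prescribed only on |i⟩|0⟩; wherever its other columns enter, they cancel through V V† = 1.
-/
theorem row_mul_adjoint (χ : (Fin (qubits n) → Bool) → (Fin (qubits d) → Bool) → ℂ)
    (i : Fin (qubits n) → Bool) (w : Fin (qubits d) → Bool) :
    ∑ i', ∑ w', (O .row).1 (Sum.elim i w) (Sum.elim i' w') *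
      (∑ i'', ∑ w'', star ((O .row).1 (Sum.elim i'' w'') (Sum.elim i' w')) * χ i'' w'') =
      χ i w := by
  have h : ((O .row).1 * star (O .row).1).mulVec (fun y => χ (fun t => y (Sum.inl t))
      fun t => y (Sum.inr t)) (Sum.elim i w) = χ i w := by
    rw [Matrix.mem_unitaryGroup_iff.mp (O .row).2, Matrix.one_mulVec]
    rfl
  rw [← Matrix.mulVec_mulVec] at h
  rw [← h]
  refine Eq.trans ?_ (sum_sumArrow (α := Fin (qubits n)) (β := Fin (qubits d)) (M := ℂ) _).symm
  refine Finset.sum_congr rfl fun i' _ => Finset.sum_congr rfl fun w' _ => ?_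
  congr 1
  symm
  refine (sum_sumArrow (α := Fin (qubits n)) (β := Fin (qubits d)) (M := ℂ) _).trans ?_
  rfl

end Unitarity

end

noncomputable section

open Wire

/-! ## The flip of the flag on rows of the memory -/

section FlagFlip

variable {n d : ℕ}

/-- Length of the ladder. -/
abbrev ladderLength (n d : ℕ) : ℕ := qubits n + qubits d + 2

/-- The wires of one iteration for data of size `n` and `d`. -/
abbrev StepWire (n d : ℕ) : Type := Wire (qubits n) (qubits d) (ladderLength n d) Unit

/-- The conditions of the controlled NOT on the flag: the index register holds a number `< n`, the
work register, the mode and the redundancy qubit are `0`. -/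
def flipConditions (n d : ℕ) : List (StepWire n d × Bool) :=
  (List.finRange (qubits n)).map
      (fun t : Fin (qubits n) => (Wire.anc () (.idx t), (n - 1).testBit t)) ++
    ((List.finRange (qubits d)).map Wire.work ++
      [Wire.mode, Wire.anc () .red]).map fun u => (u, false)

/-- The partial results of the ladder. -/
def ladderWire (n d j : ℕ) : StepWire n d := .anc () (.lad (Fin.ofNat _ j))

/-- Flip the flag under the conditions above. -/
def flipFlag (n d : ℕ) : Circuit (StepWire n d) Mem (memPort n d) :=
  Ladder.controlledNot (ladderWire n d) (flipConditions n d) (.anc () .flag)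

theorem length_flipConditions : (flipConditions n d).length = ladderLength n d := by
  simp [flipConditions, add_assoc]

/-- Each condition has its purpose. On |i⟩|0⟩ with i ≥ n the action of V is unknown, so the flag
must not flip there; mode 0 protects the part still waiting, whose work register is also 0;
redundancy 0 selects the meaningful weights. -/
theorem foldl_flipConditions (hn : 0 < n) (w : Fin (qubits d) → Bool) (m : Bool)
    (i : Fin (qubits n) → Bool) (r z f : Bool) :
    (flipConditions n d).foldl (fun acc p => leStep p.2 acc ((cfg w m i r z f) p.1)) true = true ↔
      (∃ j : Fin n, i = enc j) ∧ (w = fun _ => false) ∧ m = false ∧ r = false := by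
  rw [flipConditions, List.foldl_append, List.foldl_map, List.foldl_map,
    foldl_leStep_false _ (cfg w m i r z f : StepWire n d → Bool), Bool.and_eq_true]
  refine and_congr (foldl_leStep_enc hn i) ?_
  simp [cfg, funext_iff]

theorem act_flipFlag (hn : 0 < n) (O : ∀ o, Matrix.unitaryGroup (memPort n d o → Bool) ℂ)
    (ψ : (StepWire n d → Bool) → ℂ) (w : Fin (qubits d) → Bool) (m : Bool)
    (i : Fin (qubits n) → Bool) (r z f : Bool) :
    (flipFlag n d).act O ψ (cfg w m i r z f) = ψ (cfg w m i r z (f ^^ decide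
      ((∃ j : Fin n, i = enc j) ∧ (w = fun _ => false) ∧ m = false ∧ r = false))) := by
  rw [flipFlag, Ladder.act_controlledNot O, update_flag]
  · congr 2
    refine congrArg (f ^^ ·) ?_
    rw [Bool.eq_iff_iff, decide_eq_true_iff]
    exact foldl_flipConditions hn w m i r z f
  · intro i j hi hj h
    rw [length_flipConditions] at hi hj
    simpa [ladderWire, Fin.ext_iff, Nat.mod_eq_of_lt (Nat.lt_succ_of_le hi),
      Nat.mod_eq_of_lt (Nat.lt_succ_of_le hj)] using h
  · intro p hp j h
    simp only [flipConditions, List.mem_append, List.mem_map, ladderWire] at hp h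
    rcases hp with ⟨t, -, rfl⟩ | ⟨u, hu, rfl⟩
    · simp at h
    · simp only at h
      simp [h] at hu
  · intro j h
    simp [ladderWire] at h
  · intro p hp h
    simp only [flipConditions, List.mem_append, List.mem_map] at hp h
    rcases hp with ⟨t, -, rfl⟩ | ⟨u, hu, rfl⟩
    · simp at h
    · simp only at h
      simp [← h] at hu
  · intro j
    rfl

end FlagFlip

/-! ## One iteration -/

section Step

variable {n d q : ℕ}

/-- The circuit of iteration `k`. The rotation `u` moves the part of the state that is loaded in
this iteration from mode `1` to flag `1`; then the iteration operator is applied between the weight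
loader and its adjoint. -/
def stepCircuit (n d k : ℕ) (u : Matrix.unitaryGroup Bool ℂ) :
    Circuit (StepWire n d) Mem (memPort n d) :=
  [.elementary u (.anc () .flag) {.mode} (by simp) (by simp),
    Gate.cnot .mode (.anc () .flag), weightQuery k false, rhsQuery k, Gate.not (.anc () .flag),
    rowAdjQuery, Gate.not (.anc () .flag)] ++ flipFlag n d ++ [rowQuery, weightQuery k true]

theorem queryCount_stepCircuit (n d k : ℕ) (u : Matrix.unitaryGroup Bool ℂ) :
    (stepCircuit n d k u).queryCount = 5 := by
  rw [stepCircuit, Circuit.queryCount_append, Circuit.queryCount_append, flipFlag,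
    Ladder.queryCount_controlledNot]
  rfl

theorem gateCount_stepCircuit (n d k : ℕ) (u : Matrix.unitaryGroup Bool ℂ) :
    (stepCircuit n d k u).gateCount ≤ 6 * ladderLength n d + 7 := by
  have h := Ladder.gateCount_controlledNot (Q := Mem) (port := memPort n d) (ladderWire n d)
    (flipConditions n d) (.anc () .flag)
  rw [length_flipConditions] at h
  have h1 : (stepCircuit n d k u).gateCount = 4 + (flipFlag n d).gateCount + 0 := by
    rw [stepCircuit, Circuit.gateCount_append, Circuit.gateCount_append]
    rfl
  rw [h1, flipFlag]
  omega

/-- The state with empty ancillas and given amplitudes on the mode and the work register. -/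
def cleanState {p s L : ℕ} (Φ : Bool → (Fin s → Bool) → ℂ) (x : Wire p s L Unit → Bool) : ℂ :=
  if ∀ a, x (.anc () a) = false then Φ (x .mode) (fun t => x (.work t)) else 0

theorem cleanState_cfg {p s L : ℕ} (Φ : Bool → (Fin s → Bool) → ℂ) (w : Fin s → Bool)
    (m : Bool) (i : Fin p → Bool) (r z f : Bool) :
    cleanState Φ (cfg w m i r z f : Wire p s L Unit → Bool) =
      if (i = fun _ => false) ∧ r = false ∧ z = false ∧ f = false then Φ m w else 0 := by
  have : (∀ a, (cfg w m i r z f : Wire p s L Unit → Bool) (.anc () a) = false) ↔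
      ((i = fun _ => false) ∧ r = false ∧ z = false ∧ f = false) := by
    constructor
    · intro h
      exact ⟨funext fun t => h (.idx t), h .red, h .rhs, h .flag⟩
    · rintro ⟨rfl, rfl, rfl, rfl⟩ (_ | _ | _ | _ | _) <;> rfl
  simp only [cleanState, this]
  rfl

/-! ### Amplitude vectors in binary encoding -/

theorem ampAt_enc {N : ℕ} (x : Fin N → ℝ) (j : Fin N) : ampAt x (enc j) = (x j : ℂ) := by
  simp [ampAt, enc_injective.eq_iff]

theorem ampAt_eq_zero {N : ℕ} (x : Fin N → ℝ) (y : Fin (qubits N) → Bool)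
    (hy : ¬ ∃ j : Fin N, y = enc j) : ampAt x y = 0 :=
  Finset.sum_eq_zero fun j _ => if_neg fun h => hy ⟨j, h⟩

theorem star_ampAt {N : ℕ} (x : Fin N → ℝ) (y : Fin (qubits N) → Bool) :
    star (ampAt x y) = ampAt x y := by
  simp only [ampAt, star_sum]
  refine Finset.sum_congr rfl fun j _ => ?_
  split_ifs <;> simp

theorem sum_ampAt_mul {N : ℕ} (x : Fin N → ℝ) (F : (Fin (qubits N) → Bool) → ℂ) :
    ∑ y, ampAt x y * F y = ∑ j, (x j : ℂ) * F (enc j) := by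
  simp only [ampAt, Finset.sum_mul]
  rw [Finset.sum_comm]
  refine Finset.sum_congr rfl fun j _ => ?_
  simp

theorem planeRotation_false_false {c s : ℝ} (h : c ^ 2 + s ^ 2 = 1) :
    (planeRotation c s h).1 false false = c := by
  simp [planeRotation]

theorem planeRotation_true_false {c s : ℝ} (h : c ^ 2 + s ^ 2 = 1) :
    (planeRotation c s h).1 true false = s := by
  simp [planeRotation]

/-- The amplitudes are followed gate by gate, but only on the components that can return to clean
ancillas. The iterate survives as V V† = 1 and the column of G_k has norm 1; the NOT of the flag
replaces its component ⟨A_j, φ⟩ along each row by the loaded value, and the two uses of √ω_{k,j}, in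
G_k and its adjoint, give the weight. -/
theorem act_stepCircuit (hn : 0 < n) {a : Fin n → EuclideanSpace ℝ (Fin d)} {c ω : Fin n → ℝ}
    {τ : ℕ → Fin q → Fin n} {x₀ : EuclideanSpace ℝ (Fin d)} (hω : ∀ i, 0 < ω i)
    {O : ∀ o, Matrix.unitaryGroup (memPort n d o → Bool) ℂ} (hO : IsMemory a c ω τ x₀ O) (k : ℕ)
    {cs sn : ℝ} (hcs : cs ^ 2 + sn ^ 2 = 1) (α : ℂ) (φ : (Fin (qubits d) → Bool) → ℂ)
    (w : Fin (qubits d) → Bool) (m : Bool) :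
    (stepCircuit n d k (planeRotation cs sn hcs)).act O
      (cleanState fun m w => if m then (if w = fun _ => false then α else 0) else φ w)
      (cfg w m (fun _ => false) false false false) =
      if m then (if w = fun _ => false then cs * α else 0) else
        φ w + ∑ j, batchWeight ω τ k j * (c j / batchNorm c τ k * (sn * α) -
          ∑ w', ampAt (rowAmp a j) w' * φ w') * ampAt (rowAmp a j) w := by
  set Φ : Bool → (Fin (qubits d) → Bool) → ℂ :=
    fun m w => if m then (if w = fun _ => false then α else 0) else φ w with hΦ
  -- the state after the loading rotation, on registers that are `0`
  let Λ : Bool → Bool → (Fin (qubits d) → Bool) → ℂ := fun m f w =>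
    if m then (if f then 0 else cs * Φ true w) else if f then sn * Φ true w else φ w
  let G : (Fin (qubits n) → Bool) → Bool → ℂ := fun i r =>
    (O (.weight k)).1 (Sum.elim i fun _ => r) (fun _ => false)
  let V : (Fin (qubits n) → Bool) → (Fin (qubits d) → Bool) → (Fin (qubits n) → Bool) →
      (Fin (qubits d) → Bool) → ℂ := fun i w i' w' => (O .row).1 (Sum.elim i w) (Sum.elim i' w')
  have hG0 : ∀ i, G i false = ampAt (fun i => √(batchWeight ω τ k i)) i := hO.weight k
  have hV : ∀ (j : Fin n) i w, V i w (enc j) (fun _ => false) =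
      if i = enc j then ampAt (rowAmp a j) w else 0 := hO.row
  have hGsum : ∑ i, ∑ r, star (G i r) * G i r = 1 := weight_column_norm O k
  have hVV := row_mul_adjoint O
  set ψ₀ : (StepWire n d → Bool) → ℂ := cleanState Φ with hψ₀
  rw [stepCircuit, Circuit.act_append, Circuit.act_append]
  simp only [Circuit.act_cons, Circuit.act_nil]
  set ψ₁ := Gate.act O (.elementary _ _ _ _ _) ψ₀ with hψ₁
  set ψ₂ := Gate.act O (Gate.cnot _ _) ψ₁ with hψ₂
  set ψ₃ := Gate.act O (weightQuery k false) ψ₂ with hψ₃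
  set ψ₄ := Gate.act O (rhsQuery k) ψ₃ with hψ₄
  set ψ₅ := Gate.act O (Gate.not _) (Gate.act O rowAdjQuery (Gate.act O (Gate.not _) ψ₄)) with hψ₅
  set ψ₆ := (flipFlag n d).act O ψ₅ with hψ₆
  set ψ₇ := Gate.act O rowQuery ψ₆ with hψ₇
  -- After the rotation the CNOT clears the mode where the flag is set, so the loaded part joins the
  -- iterate in mode 0, told apart by the flag alone.
  have h₂ : ∀ w m i r z f, ψ₂ (cfg w m i r z f) =
      if (i = fun _ => false) ∧ r = false ∧ z = false then Λ m f w else 0 := by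
    intro w m i r z f
    rw [hψ₂, act_cnot_mode, hψ₁, Gate.act]
    simp only [Finset.mem_singleton, forall_eq, update_flag, hψ₀, cleanState_cfg, cfg,
      Fintype.sum_bool]
    cases m <;> cases f <;>
      simp [Λ, hΦ, planeRotation_false_false, planeRotation_true_false]
  have h₃ : ∀ w m i r z f, ψ₃ (cfg w m i r z f) = if z = false then G i r * Λ m f w else 0 := by
    intro w m i r z f
    rw [hψ₃, act_weightQuery, Finset.sum_eq_single (fun _ => false) (fun i' _ hi' => by
      simp [h₂, hi']) (by simp), Fintype.sum_bool]
    have : (Sum.elim (fun _ => false) fun _ => false : Fin (qubits n) ⊕ Unit → Bool) =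
      fun _ => false := by ext (_ | _) <;> rfl
    simp only [h₂, this, G, true_and, reduceCtorEq, false_and, if_false, mul_zero,
      zero_add, mul_ite]
    rfl
  have h₄₀ : ∀ w m i r, ψ₄ (cfg w m i r false false) = G i r * Λ m false w := by
    intro w m i r
    rw [hψ₄, act_rhsQuery_false, h₃, if_pos rfl]
  -- The rotation R_k is unknown on indices outside the batch; the weight amplitude vanishes there,
  -- so they do not contribute.
  have h₄₁ : ∀ w m j, ψ₄ (cfg w m (enc j) false false true) =
      √(batchWeight ω τ k j) * (c j / batchNorm c τ k) * Λ m true w := by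
    intro w m j
    rw [hψ₄, act_rhsQuery]
    simp only [Fintype.sum_bool, h₃, reduceCtorEq, if_false, if_true, mul_zero, zero_add, hG0]
    have hcomm : ∀ i', (O (.rhs k)).1 (Sum.elim (enc j) fun _ => false)
        (Sum.elim i' fun _ => false) * (ampAt (fun i => √(batchWeight ω τ k i)) i' * Λ m true w) =
        ampAt (fun i => √(batchWeight ω τ k i)) i' * ((O (.rhs k)).1
          (Sum.elim (enc j) fun _ => false) (Sum.elim i' fun _ => false) * Λ m true w) :=
      fun i' => by ring
    simp only [hcomm]
    rw [sum_ampAt_mul, Finset.sum_eq_single j]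
    · by_cases hj : ∃ l, τ k l = j
      · obtain ⟨l, rfl⟩ := hj
        rw [hO.rhs k l (enc (τ k l)) false]
        simp
        ring
      · simp [batchWeight_eq_zero ω τ k j (by simpa using hj)]
    · intro j' _ hj'
      by_cases hj : ∃ l, τ k l = j'
      · obtain ⟨l, rfl⟩ := hj
        rw [hO.rhs k l (enc j) false, if_neg fun h => hj' (enc_injective h).symm]
        simp
      · simp [batchWeight_eq_zero ω τ k j' (by simpa using hj)]
    · simp
  have h₅₁ : ∀ w m i r, ψ₅ (cfg w m i r false true) = ψ₄ (cfg w m i r false true) := by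
    intro w m i r
    rw [hψ₅, act_not_flag, Bool.not_true, act_rowAdjQuery_false, act_not_flag]
    rfl
  have h₅₀ : ∀ w m i r, ψ₅ (cfg w m i r false false) =
      ∑ i', ∑ w', star (V i' w' i w) * (G i' r * Λ m false w') := by
    intro w m i r
    rw [hψ₅, act_not_flag, Bool.not_false, act_rowAdjQuery]
    simp only [act_not_flag, Bool.not_true, h₄₀, V]
  -- The flip is written as a correction to the identity, so that V V† = 1 handles the first term
  -- and only the prescribed columns of V meet the second.
  have h₆ : ∀ w m i r, ψ₆ (cfg w m i r false false) = ψ₅ (cfg w m i r false false) +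
      if (∃ j : Fin n, i = enc j) ∧ (w = fun _ => false) ∧ m = false ∧ r = false then
        ψ₅ (cfg w m i r false true) - ψ₅ (cfg w m i r false false) else 0 := by
    intro w m i r
    rw [hψ₆, act_flipFlag hn]
    split_ifs with h <;> simp [h]
  have h₇ : ∀ w m i r, ψ₇ (cfg w m i r false false) = G i r * Λ m false w +
      if m = false ∧ r = false then ∑ j, (if i = enc j then ampAt (rowAmp a j) w else 0) *
        (√(batchWeight ω τ k j) * (c j / batchNorm c τ k * (sn * α) -
          ∑ w', ampAt (rowAmp a j) w' * φ w')) else 0 := by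
    intro w m i r
    rw [hψ₇, act_rowQuery]
    simp only [h₆, mul_add, Finset.sum_add_distrib]
    congr 1
    · simp only [h₅₀]
      exact hVV (fun i w => G i r * Λ m false w) i w
    · split_ifs with h
      · obtain ⟨rfl, rfl⟩ := h
        simp only [and_true]
        rw [Finset.sum_comm, Finset.sum_eq_single (fun _ => false) (fun w' _ hw' => by
          simp [hw']) (by simp)]
        simp only [and_true]
        rw [← Finset.sum_subset (Finset.subset_univ (Finset.univ.image (enc : Fin n → _)))
          (fun i' _ hi' => by
            rw [if_neg, mul_zero]
            rintro ⟨j, rfl⟩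
            simp at hi'), Finset.sum_image fun _ _ _ _ h => enc_injective h]
        refine Finset.sum_congr rfl fun j _ => ?_
        rw [if_pos ⟨j, rfl⟩, h₅₁, h₅₀, h₄₁]
        have h1 : ∑ i', ∑ w', star (V i' w' (enc j) fun _ => false) *
            (G i' false * Λ false false w') =
            √(batchWeight ω τ k j) * ∑ w', ampAt (rowAmp a j) w' * φ w' := by
          -- The component of V†φ on |j⟩|0⟩ involves only the prescribed column |j⟩|A_j⟩ of V, so it
          -- is the inner product with A_j.
          rw [Finset.sum_eq_single (enc j) (fun i' _ hi' => by simp [hV, hi']) (by simp),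
            Finset.mul_sum]
          refine Finset.sum_congr rfl fun w' _ => ?_
          rw [hV, if_pos rfl, star_ampAt, hG0, ampAt_enc]
          simp only [Λ, Bool.false_eq_true, if_false]
          ring
        have h2 : (O .row).1 (Sum.elim i w) (Sum.elim (enc j) fun _ => false) =
            if i = enc j then ampAt (rowAmp a j) w else 0 := hV j i w
        rw [h1, h2]
        simp only [Λ, hΦ, Bool.false_eq_true, if_false, if_true]
        ring
      · refine Finset.sum_eq_zero fun i' _ => Finset.sum_eq_zero fun w' _ => ?_
        rw [if_neg fun h' => h h'.2.2, mul_zero]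
  rw [act_weightQuery_adj]
  have hz : (Sum.elim (fun _ => false) fun _ => false : Fin (qubits n) ⊕ Unit → Bool) =
    fun _ => false := by ext (_ | _) <;> rfl
  rw [hz]
  -- Ending on index and redundancy 0 after G_k† means pairing with the column G_k|0⟩.
  have hsplit : ∑ i', ∑ r', star (G i' r') * ψ₇ (cfg w m i' r' false false) =
      Λ m false w + if m = false then ∑ j, batchWeight ω τ k j *
        (c j / batchNorm c τ k * (sn * α) - ∑ w', ampAt (rowAmp a j) w' * φ w') *
          ampAt (rowAmp a j) w else 0 := by
    simp only [h₇, mul_add, Finset.sum_add_distrib]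
    congr 1
    · simp only [← mul_assoc, ← Finset.sum_mul, hGsum, one_mul]
    · split_ifs with hm
      · simp only [hm, true_and, Fintype.sum_bool, reduceCtorEq, if_false, if_true, mul_zero,
          zero_add, hG0, star_ampAt]
        rw [sum_ampAt_mul]
        simp only [enc_injective.eq_iff, ite_mul, zero_mul, Finset.sum_ite_eq, Finset.mem_univ,
          if_true]
        refine Finset.sum_congr rfl fun j _ => ?_
        have hsq : (√(batchWeight ω τ k j) : ℂ) * √(batchWeight ω τ k j) = batchWeight ω τ k j := by
          rw [← Complex.ofReal_mul, Real.mul_self_sqrt (batchWeight_nonneg hω τ k j)]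
        rw [← hsq]
        ring
      · simp [hm]
  refine hsplit.trans ?_
  cases m <;> simp [Λ, hΦ]

end Step

end

noncomputable section

open Wire

/-! ## The whole circuit -/

theorem Gate.act_elementary_of_forall {W Q : Type} {port : Q → Type} [DecidableEq W]
    [∀ o, Fintype (port o)] [∀ o, DecidableEq (port o)]
    (O : ∀ o, Matrix.unitaryGroup (port o → Bool) ℂ) {u : Matrix.unitaryGroup Bool ℂ} {t : W}
    {cs : Finset W} {hcard : cs.card ≤ 2} {ht : t ∉ cs} (ψ : (W → Bool) → ℂ)
    {x : W → Bool} (hx : ∀ w ∈ cs, x w = true) :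
    (elementary u t cs hcard ht : Gate W Q port).act O ψ x =
      ∑ y : Bool, (u : Matrix Bool Bool ℂ) (x t) y * ψ (Function.update x t y) :=
  if_pos hx

section Iteration

variable {n d q K : ℕ}

/-- The wires of the circuit for `K` iterations. -/
abbrev AllWires (n d K : ℕ) : Type := Wire (qubits n) (qubits d) (ladderLength n d) (Fin K)

/-- On the part where the ancillas of the first `k` iterations are `0`, the ancillas of the other
iterations are `0` as well and the amplitudes on the mode and the work register are `Φ`. -/
def IsCleanFrom {p s L : ℕ} (k : ℕ) (Φ : Bool → (Fin s → Bool) → ℂ)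
    (ψ : (Wire p s L (Fin K) → Bool) → ℂ) : Prop :=
  ∀ x, (∀ j : Fin K, j.val < k → ∀ a, x (.anc j a) = false) →
    ψ x = if ∀ j : Fin K, k ≤ j.val → ∀ a, x (.anc j a) = false then
      Φ (x .mode) (fun t => x (.work t)) else 0

theorem extend_single_of_ne {p s L : ℕ} {k j : Fin K} (h : j ≠ k)
    (y : Wire p s L Unit → Bool) (x : Wire p s L (Fin K) → Bool) (a : Ancilla p L) :
    Function.extend (single k) y x (.anc j a) = x (.anc j a) := by
  refine Function.extend_apply' _ _ _ ?_
  rintro ⟨_ | _ | _, hv⟩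
  · cases hv
  · cases hv
  · cases hv
    exact h rfl

/-- With the ancillas of other iterations frozen, the state is either a clean state of one iteration
or zero. What leaves nonzero ancillas behind is garbage: no later iteration touches them, so `hP`
only has to describe the clean output. -/
theorem IsCleanFrom.act_onWires {Q : Type} {port : Q → Type} [∀ o, Fintype (port o)]
    [∀ o, DecidableEq (port o)] {p s L : ℕ} {O : ∀ o, Matrix.unitaryGroup (port o → Bool) ℂ}
    {k : ℕ} (hk : k < K) {Φ Φ' : Bool → (Fin s → Bool) → ℂ}
    {ψ : (Wire p s L (Fin K) → Bool) → ℂ} (hψ : IsCleanFrom k Φ ψ)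
    {P : Circuit (Wire p s L Unit) Q port}
    (hP : ∀ w m, P.act O (cleanState Φ) (cfg w m (fun _ => false) false false false) = Φ' m w) :
    IsCleanFrom (k + 1) Φ' ((P.onWires (single (⟨k, hk⟩ : Fin K))).act O ψ) := by
  intro x hx
  rw [Circuit.act_onWires]
  have he : ∀ (y : Wire p s L Unit → Bool) (v : Wire p s L Unit),
      Function.extend (single (⟨k, hk⟩ : Fin K)) y x (single (⟨k, hk⟩ : Fin K) v) = y v := fun y v =>
    (single (⟨k, hk⟩ : Fin K)).injective.extend_apply _ _ v
  have hslice : ∀ y, ψ (Function.extend (single (⟨k, hk⟩ : Fin K)) y x) =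
      if ∀ j : Fin K, k + 1 ≤ j.val → ∀ a, x (.anc j a) = false then cleanState Φ y else 0 := by
    intro y
    rw [hψ (Function.extend (single (⟨k, hk⟩ : Fin K)) y x) fun j hj a => by
      rw [extend_single_of_ne (fun h => by simp [h] at hj), hx j (by omega)]]
    have h1 : (∀ j : Fin K, k ≤ j.val → ∀ a,
        Function.extend (single (⟨k, hk⟩ : Fin K)) y x (.anc j a) = false) ↔
        (∀ j : Fin K, k + 1 ≤ j.val → ∀ a, x (.anc j a) = false) ∧
          ∀ a, y (.anc () a) = false := by
      constructor
      · intro h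
        refine ⟨fun j hj a => ?_, fun a => ?_⟩
        · rw [← h j (by omega) a, extend_single_of_ne]
          rintro rfl
          simp at hj
        · rw [← h ⟨k, hk⟩ le_rfl a]
          exact (he y (.anc () a)).symm
      · rintro ⟨h, h'⟩ j hj a
        by_cases hjk : j = ⟨k, hk⟩
        · subst hjk
          exact (he y (.anc () a)).trans (h' a)
        · rw [extend_single_of_ne hjk, h j]
          have : j.val ≠ k := fun h => hjk (Fin.ext h)
          omega
    simp only [h1, cleanState, ite_and]
    congr 1
    congr 1
    exact congrArg₂ Φ (he y .mode) (funext fun t => he y (.work t))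
  simp only [hslice]
  split_ifs with hrest
  · have hcfg : x ∘ single (⟨k, hk⟩ : Fin K) = cfg (fun t => x (.work t)) (x .mode) (fun _ => false)
        false false false := by
      ext v
      rcases v with _ | _ | ⟨_, _ | _ | _ | _ | _⟩
      · rfl
      · rfl
      all_goals exact hx ⟨k, hk⟩ (Nat.lt_succ_self k) _
    rw [hcfg]
    exact hP _ _
  · rw [Circuit.act_zero]

/-- The first `k` iterations. -/
def iterations (n d : ℕ) (u : ℕ → Matrix.unitaryGroup Bool ℂ) :
    (k : ℕ) → k ≤ K → Circuit (AllWires n d K) Mem (memPort n d)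
  | 0, _ => []
  | k + 1, h => iterations n d u k (Nat.le_of_succ_le h) ++
      (stepCircuit n d k (u k)).onWires (single ⟨k, h⟩)

theorem queryCount_iterations (u : ℕ → Matrix.unitaryGroup Bool ℂ) (k : ℕ) (hk : k ≤ K) :
    (iterations n d u k hk).queryCount = 5 * k := by
  induction k with
  | zero => rfl
  | succ k ih =>
    rw [iterations, Circuit.queryCount_append, ih, Circuit.queryCount_onWires,
      queryCount_stepCircuit]
    ring

theorem gateCount_iterations (u : ℕ → Matrix.unitaryGroup Bool ℂ) (k : ℕ) (hk : k ≤ K) :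
    (iterations n d u k hk).gateCount ≤ (6 * ladderLength n d + 7) * k := by
  induction k with
  | zero => exact le_rfl
  | succ k ih =>
    rw [iterations, Circuit.gateCount_append, Circuit.gateCount_onWires, mul_add, mul_one]
    exact add_le_add (ih _) (gateCount_stepCircuit n d k _)

/-- The preparation of the initial vector, controlled by the mode. -/
def initQuery (n d K : ℕ) : Gate (AllWires n d K) Mem (memPort n d) :=
  .query .init false (workEmb : Fin (qubits d) ↪ AllWires n d K) {.mode} (by simp)
    (fun _ => Finset.notMem_singleton.mpr fun h => by cases h)

theorem act_initQuery (O : ∀ o, Matrix.unitaryGroup (memPort n d o → Bool) ℂ)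
    (ψ : (AllWires n d K → Bool) → ℂ) {x : AllWires n d K → Bool} (hx : x .mode = true) :
    (initQuery n d K).act O ψ x = ∑ y : Fin (qubits d) → Bool,
      (O .init).1 (fun t => x (.work t)) y * ψ (Function.extend workEmb y x) :=
  Gate.act_query_of_forall O ψ (by simpa)

/-- Preparation of the superposition of the initial vector (mode `0`) and the part that waits for
being loaded (mode `1`). -/
def initCircuit (n d K : ℕ) (u : Matrix.unitaryGroup Bool ℂ) :
    Circuit (AllWires n d K) Mem (memPort n d) :=
  [.elementary u .mode ∅ (by simp) (by simp), Gate.not .mode,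
    initQuery n d K, Gate.not .mode]

theorem extend_work {p s L : ℕ} {κ : Type} (y : Fin s → Bool) (x : Wire p s L κ → Bool) :
    (∀ t, Function.extend workEmb y x (.work t) = y t) ∧
      Function.extend workEmb y x .mode = x .mode ∧
      ∀ k a, Function.extend workEmb y x (.anc k a) = x (.anc k a) := by
  refine ⟨fun t => workEmb.injective.extend_apply _ _ t, ?_, fun k a => ?_⟩ <;>
  · refine Function.extend_apply' _ _ _ ?_
    rintro ⟨t, h⟩
    cases h

theorem isCleanFrom_initCircuit {a : Fin n → EuclideanSpace ℝ (Fin d)} {c ω : Fin n → ℝ}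
    {τ : ℕ → Fin q → Fin n} {x₀ : EuclideanSpace ℝ (Fin d)}
    {O : ∀ o, Matrix.unitaryGroup (memPort n d o → Bool) ℂ} (hO : IsMemory a c ω τ x₀ O)
    {cs sn : ℝ} (hcs : cs ^ 2 + sn ^ 2 = 1) :
    IsCleanFrom 0 (fun m (w : Fin (qubits d) → Bool) =>
      if m then (if w = fun _ => false then (sn : ℂ) else 0)
      else cs * ampAt x₀ w)
      ((initCircuit n d K (planeRotation cs sn hcs)).act O (Pi.single (fun _ => false) 1)) := by
  rw [initCircuit]
  simp only [Circuit.act_cons, Circuit.act_nil]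
  set ψ₁ := Gate.act O (.elementary (planeRotation cs sn hcs) .mode ∅ (by simp) (by simp))
    (Pi.single (fun _ : AllWires n d K => false) 1) with hψ₁
  set ψ₂ := Gate.act O (Gate.not .mode) ψ₁ with hψ₂
  set ψ₃ := Gate.act O (initQuery n d K) ψ₂ with hψ₃
  have h₁ : ∀ x, ψ₁ x = if (∀ j a, x (.anc j a) = false) ∧ ∀ t, x (.work t) = false then
      (planeRotation cs sn hcs).1 (x .mode) false else 0 := by
    intro x
    have hx : Function.update x .mode false = (fun _ => false) ↔
        (∀ j a, x (.anc j a) = false) ∧ ∀ t, x (.work t) = false := by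
      constructor
      · intro h
        exact ⟨fun j a => by simpa using congrFun h (.anc j a),
          fun t => by simpa using congrFun h (.work t)⟩
      · rintro ⟨h, h'⟩
        ext (t | _ | ⟨j, a⟩) <;> simp [h, h']
    have hx' : Function.update x .mode true ≠ fun _ => false := fun h => by
      simpa using congrFun h .mode
    rw [hψ₁]
    refine (Gate.act_elementary_of_forall O _ fun w hw =>
      absurd hw (Finset.notMem_empty w)).trans ?_
    rw [Fintype.sum_bool, Pi.single_apply, Pi.single_apply, if_neg hx', mul_zero, zero_add]
    simp only [hx, mul_ite, mul_one, mul_zero]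
  have h₂ : ∀ x, ψ₂ x = if (∀ j a, x (.anc j a) = false) ∧ ∀ t, x (.work t) = false then
      (planeRotation cs sn hcs).1 (!x .mode) false else 0 := by
    intro x
    rw [hψ₂, Gate.act_not, h₁]
    simp
  intro x _
  simp only [Nat.zero_le, true_imp_iff]
  rw [Gate.act_not, hψ₃]
  cases hm : x .mode
  · rw [act_initQuery O ψ₂ (by simp), Finset.sum_eq_single fun _ => false]
    · obtain ⟨hw, hm', hanc⟩ := extend_work (fun _ => false)
        (Function.update x (.mode : AllWires n d K) !false)
      have hupd : (fun t => Function.update x (.mode : AllWires n d K) (!false) (.work t)) =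
          fun t => x (.work t) := by
        ext t
        exact Function.update_of_ne (by simp) _ _
      have hi : (O .init).1 (fun t => Function.update x (.mode : AllWires n d K) (!false)
          (.work t)) (fun _ => false) = ampAt x₀ fun t => x (.work t) :=
        (congrArg (fun z => (O .init).1 z fun _ => false) hupd).trans (hO.init _)
      refine (congrArg₂ (· * ·) hi (h₂ _)).trans ?_
      simp only [hm', hw, hanc]
      simp [planeRotation_false_false, mul_comm]
    · intro y _ hy
      refine mul_eq_zero_of_right _ ((h₂ _).trans (if_neg ?_))
      rintro ⟨-, h⟩
      refine hy (funext fun t => ?_)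
      rw [← h t]
      exact ((extend_work y _).1 t).symm
    · simp
  · refine (Gate.act_query_of_not_forall O ψ₂ (by simp)).trans ?_
    rw [h₂]
    simp [planeRotation_true_false, ite_and, funext_iff]

/-! ### Rotation angles and waiting amplitudes -/

theorem exists_rotation {α β γ : ℝ} (h : α ^ 2 = β ^ 2 + γ ^ 2) :
    ∃ c s : ℝ, c ^ 2 + s ^ 2 = 1 ∧ s * α = β ∧ c * α = γ := by
  by_cases hα : α = 0
  · subst hα
    have hβ : β = 0 := by nlinarith [sq_nonneg β, sq_nonneg γ]
    have hγ : γ = 0 := by nlinarith [sq_nonneg β, sq_nonneg γ]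
    exact ⟨1, 0, by norm_num, by simp [hβ], by simp [hγ]⟩
  · refine ⟨γ / α, β / α, ?_, by field_simp, by field_simp⟩
    field_simp
    linarith

/-- The amplitude of the part that is still to be loaded after `k` of `K` iterations. -/
def waitAmp (c : Fin n → ℝ) (τ : ℕ → Fin q → Fin n) (K k : ℕ) : ℝ :=
  √(algV c τ K ^ 2 - algV c τ k ^ 2) / algV c τ K

theorem algV_mono (c : Fin n → ℝ) (τ : ℕ → Fin q → Fin n) : Monotone (algV c τ) :=
  monotone_nat_of_le_succ fun k => by
    have := algV_succ_sq c τ k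
    exact abs_le_of_sq_le_sq' (by nlinarith [sq_nonneg (batchNorm c τ k)]) (algV_pos c τ _).le |>.2

theorem waitAmp_sq (c : Fin n → ℝ) (τ : ℕ → Fin q → Fin n) {k : ℕ} (hk : k ≤ K) :
    waitAmp c τ K k ^ 2 = (algV c τ K ^ 2 - algV c τ k ^ 2) / algV c τ K ^ 2 := by
  have h1 := algV_mono c τ hk
  have h2 := algV_pos c τ k
  rw [waitAmp, div_pow, Real.sq_sqrt]
  nlinarith

theorem sq_inv_algV_add_sq_waitAmp (c : Fin n → ℝ) (τ : ℕ → Fin q → Fin n) (K : ℕ) :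
    (1 / algV c τ K) ^ 2 + waitAmp c τ K 0 ^ 2 = 1 := by
  have := (algV_pos c τ K).ne'
  rw [waitAmp_sq c τ (Nat.zero_le K)]
  simp only [algV]
  field_simp
  ring

/-- The squared waiting amplitude drops by exactly the squared batch norm over v_K², so a rotation
splits it. For k ≥ K any rotation serves; the identity makes the choice total in k. -/
theorem exists_loadRotation (c : Fin n → ℝ) (τ : ℕ → Fin q → Fin n) (K k : ℕ) :
    ∃ cs sn : ℝ, ∃ _ : cs ^ 2 + sn ^ 2 = 1, k < K →
      sn * waitAmp c τ K k = batchNorm c τ k / algV c τ K ∧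
        cs * waitAmp c τ K k = waitAmp c τ K (k + 1) := by
  by_cases hk : k < K
  · obtain ⟨cs, sn, h, h1, h2⟩ := exists_rotation (α := waitAmp c τ K k)
      (β := batchNorm c τ k / algV c τ K) (γ := waitAmp c τ K (k + 1)) (by
        have := (algV_pos c τ K).ne'
        rw [waitAmp_sq c τ hk.le, waitAmp_sq c τ hk, algV_succ_sq]
        field_simp
        ring)
    exact ⟨cs, sn, h, fun _ => ⟨h1, h2⟩⟩
  · exact ⟨1, 0, by norm_num, fun h => absurd h hk⟩

/-- Cancellation survives a vanishing batch norm: then c_i = 0 on the batch, and off the batch the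
weight is 0. -/
theorem batchWeight_mul_div_batchNorm (c ω : Fin n → ℝ) (τ : ℕ → Fin q → Fin n) (k : ℕ)
    (i : Fin n) :
    batchWeight ω τ k i * (c i / batchNorm c τ k * batchNorm c τ k) =
      batchWeight ω τ k i * c i := by
  by_cases hi : ∃ j, τ k j = i
  · obtain ⟨j, rfl⟩ := hi
    by_cases hB : batchNorm c τ k = 0
    · have h0 : 0 ≤ ∑ j, c (τ k j) ^ 2 := Finset.sum_nonneg fun _ _ => sq_nonneg _
      rw [batchNorm, Real.sqrt_eq_zero h0,
        Finset.sum_eq_zero_iff_of_nonneg fun _ _ => sq_nonneg _] at hB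
      simp [pow_eq_zero_iff two_ne_zero |>.mp (hB j (Finset.mem_univ j))]
    · rw [div_mul_cancel₀ _ hB]
  · rw [batchWeight_eq_zero ω τ k i (by simpa using hi), zero_mul, zero_mul]

/-- The invariant of the circuit: x_k / v_K in mode 0, the waiting amplitude in mode 1. After K
iterations the latter is zero. -/
theorem isCleanFrom_iterations (hn : 0 < n) {a : Fin n → EuclideanSpace ℝ (Fin d)}
    {b c ω : Fin n → ℝ} {τ : ℕ → Fin q → Fin n} {x₀ : EuclideanSpace ℝ (Fin d)}
    (hω : ∀ i, 0 < ω i) (ha : ∀ i, a i ≠ 0) (hc : ∀ i, c i = b i / ‖a i‖)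
    {O : ∀ o, Matrix.unitaryGroup (memPort n d o → Bool) ℂ} (hO : IsMemory a c ω τ x₀ O)
    {cs sn : ℕ → ℝ} (hcs : ∀ k, cs k ^ 2 + sn k ^ 2 = 1)
    (hload : ∀ k, k < K → sn k * waitAmp c τ K k = batchNorm c τ k / algV c τ K ∧
      cs k * waitAmp c τ K k = waitAmp c τ K (k + 1)) (k : ℕ) (hk : k ≤ K) :
    IsCleanFrom k (fun m (w : Fin (qubits d) → Bool) =>
      if m then (if w = fun _ => false then (waitAmp c τ K k : ℂ) else 0)
      else (1 / algV c τ K : ℝ) * ampAt (sgd a b ω τ x₀ k) w)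
      (Circuit.act O (initCircuit n d K (planeRotation _ _ (sq_inv_algV_add_sq_waitAmp c τ K)) ++
        iterations n d (fun k => planeRotation _ _ (hcs k)) k hk)
        (Pi.single (fun _ => false) 1)) := by
  induction k with
  | zero =>
    rw [iterations, List.append_nil]
    exact isCleanFrom_initCircuit hO _
  | succ k ih =>
    rw [iterations, ← List.append_assoc, Circuit.act_append]
    refine (ih (Nat.le_of_succ_le hk)).act_onWires hk fun w m => ?_
    rw [act_stepCircuit hn hω hO k (hcs k)]
    obtain ⟨h1, h2⟩ := hload k hk
    cases m
    · simp only [Bool.false_eq_true, if_false]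
      -- Work states that encode no coordinate have amplitude zero in the iterate and in every row.
      by_cases hw : ∃ l : Fin d, w = enc l
      · obtain ⟨l, rfl⟩ := hw
        simp only [ampAt_enc, sum_ampAt_mul, sgd_succ_apply ω τ x₀ ha hc]
        have hsum : ∀ j, (batchWeight ω τ k j : ℂ) * (c j / batchNorm c τ k *
            (sn k * waitAmp c τ K k) - ∑ l', (rowAmp a j l' : ℂ) *
              ((1 / algV c τ K : ℝ) * sgd a b ω τ x₀ k l')) * rowAmp a j l =
            (1 / algV c τ K : ℝ) * (batchWeight ω τ k j *
              (c j - ∑ l', rowAmp a j l' * sgd a b ω τ x₀ k l') * rowAmp a j l : ℝ) := by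
          intro j
          have h3 := batchWeight_mul_div_batchNorm c ω τ k j
          have h4 : ∑ l', rowAmp a j l' * (1 / algV c τ K * sgd a b ω τ x₀ k l') =
              1 / algV c τ K * ∑ l', rowAmp a j l' * sgd a b ω τ x₀ k l' := by
            rw [Finset.mul_sum]
            exact Finset.sum_congr rfl fun _ _ => by ring
          have h5 : batchWeight ω τ k j * (c j / batchNorm c τ k * (sn k * waitAmp c τ K k) -
              ∑ l', rowAmp a j l' * (1 / algV c τ K * sgd a b ω τ x₀ k l')) * rowAmp a j l =
              1 / algV c τ K * (batchWeight ω τ k j *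
              (c j - ∑ l', rowAmp a j l' * sgd a b ω τ x₀ k l') * rowAmp a j l) := by
            rw [h1, h4]
            linear_combination (rowAmp a j l / algV c τ K) * h3
          exact_mod_cast congrArg (Complex.ofReal) h5
        simp only [hsum]
        rw [← Finset.mul_sum]
        push_cast
        ring
      · simp [ampAt_eq_zero _ _ hw]
    · simp only [if_true]
      rw [← h2]
      push_cast
      rfl

end Iteration

/-- Rounding up costs at most one, and 1 ≤ log n / log 2 for n ≥ 2; so 2 / log 2 < 3 suffices. -/
theorem qubits_le_log {n : ℕ} (hn : 2 ≤ n) : (qubits n : ℝ) ≤ 3 * Real.log n := by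
  have h1 : 2 ^ (qubits n).pred < n := Nat.pow_pred_clog_lt_self one_lt_two hn
  have h2 : ((qubits n).pred : ℝ) * Real.log 2 ≤ Real.log n := by
    rw [← Real.log_pow]
    exact Real.log_le_log (by positivity) (by exact_mod_cast h1.le)
  have h3 : Real.log 2 ≤ Real.log n := Real.log_le_log two_pos (by exact_mod_cast hn)
  have h4 : (qubits n : ℝ) ≤ (qubits n).pred + 1 := by
    have : qubits n ≤ (qubits n).pred + 1 := by rw [Nat.pred_eq_sub_one]; omega
    exact_mod_cast this
  nlinarith [Real.log_two_gt_d9]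

end

theorem corollary2 :
    ∃ C : ℝ, ∀ (n d q K : ℕ), 2 ≤ n → d ≤ n → 1 ≤ q → 1 ≤ K →
      ∀ (τ : ℕ → Fin q → Fin n) (ω c : Fin n → ℝ), (∀ i, 0 < ω i) →
        (∀ k, ∑ j : Fin q, ω (τ k j) ≤ q) →
        ∃ (W : Type) (_ : Fintype W) (_ : DecidableEq W) (work : Fin (qubits d) ↪ W)
          (P : Circuit W Mem (memPort n d)),
          (P.queryCount : ℝ) ≤ C * K ∧
          (P.gateCount : ℝ) ≤ C * (K * Real.log n) ∧
          ∀ (a : Fin n → EuclideanSpace ℝ (Fin d)) (b : Fin n → ℝ)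
            (x₀ : EuclideanSpace ℝ (Fin d)),
            (∀ i, a i ≠ 0) → (∀ i, c i = b i / ‖a i‖) → ‖x₀‖ = 1 →
            (∀ j, algOutput a c ω τ x₀ K j = sgd a b ω τ x₀ K j / algV c τ K) ∧
            ∀ O : (∀ o, Matrix.unitaryGroup (memPort n d o → Bool) ℂ),
              IsMemory a c ω τ x₀ O →
              ∀ y : Fin (qubits d) → Bool,
                P.run O (Function.extend work y fun _ => false) =
                  ampAt (algOutput a c ω τ x₀ K) y := by
  -- 102 = 34 · 3: at most 34 gates per iteration and index qubit, and at most 3 log n index qubits.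
  -- The 5K + 1 queries are far below this.
  refine ⟨102, fun n d q K hn hd hq hK τ ω c hω _ => ?_⟩
  choose cs sn hcs hload using exists_loadRotation c τ K
  refine ⟨AllWires n d K, inferInstance, inferInstance, Wire.workEmb,
    initCircuit n d K (planeRotation _ _ (sq_inv_algV_add_sq_waitAmp c τ K)) ++
      iterations n d (fun k => planeRotation _ _ (hcs k)) K le_rfl, ?_, ?_, ?_⟩
  · rw [Circuit.queryCount_append, queryCount_iterations]
    have h1 : (initCircuit n d K
        (planeRotation _ _ (sq_inv_algV_add_sq_waitAmp c τ K))).queryCount = 1 := rfl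
    rw [h1]
    have hK' : (1 : ℝ) ≤ K := by exact_mod_cast hK
    push_cast
    linarith
  · rw [Circuit.gateCount_append]
    have h1 : (initCircuit n d K
        (planeRotation _ _ (sq_inv_algV_add_sq_waitAmp c τ K))).gateCount = 3 := rfl
    have h2 := gateCount_iterations (n := n) (d := d) (fun k => planeRotation _ _ (hcs k)) K le_rfl
    have h3 : qubits d ≤ qubits n := Nat.clog_mono_right 2 hd
    have h4 : 1 ≤ qubits n := Nat.clog_pos one_lt_two hn
    -- With d ≤ n the bracket is at most 12 `qubits n` + 19, and `qubits n` is at least 1.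
    have h5 : (6 * ladderLength n d + 7) * K ≤ (31 * qubits n) * K :=
      Nat.mul_le_mul_right K (by unfold ladderLength; omega)
    have h6 : 1 * 1 ≤ qubits n * K := Nat.mul_le_mul h4 hK
    have h7 := qubits_le_log hn
    rw [h1]
    have h8 : 3 + (iterations n d (fun k => planeRotation _ _ (hcs k)) K le_rfl).gateCount ≤
        34 * (qubits n * K) := by nlinarith
    calc _ ≤ ((34 * (qubits n * K) : ℕ) : ℝ) := by exact_mod_cast h8
      _ = 34 * K * (qubits n : ℝ) := by push_cast; ring
      _ ≤ 34 * K * (3 * Real.log n) := by gcongr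
      _ = 102 * (K * Real.log n) := by ring
  · intro a b x₀ ha hc _
    have hout := algOutput_eq hq τ x₀ hω ha hc K
    refine ⟨hout, fun O hO y => ?_⟩
    have hclean := isCleanFrom_iterations (by omega) hω ha hc hO hcs hload K le_rfl
    obtain ⟨hw, hm, hanc⟩ := extend_work (κ := Fin K) (p := qubits n) (L := ladderLength n d) y
      fun _ => false
    have h := hclean (Function.extend Wire.workEmb y fun _ => false) fun j _ a => hanc j a
    rw [if_pos fun j _ a => hanc j a, hm, funext hw] at h
    refine h.trans ?_
    simp only [Bool.false_eq_true, if_false, ampAt, hout, Finset.mul_sum]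
    refine Finset.sum_congr rfl fun j _ => ?_
    split_ifs
    · push_cast
      ring
    · rw [mul_zero]
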